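/- Let $q,r\ge 2$ be integers and let $\mathbb T_q,\mathbb T_r$ be the homogeneous trees of degrees $q+1$ and $r+1$, with roots $o_1,o_2$ and fixed reference ends $\omega_1,\omega_2$. For a vertex $x$ of one of these trees, with root $o$ and reference end $\omega$, let $c$ be the vertex at which the geodesic rays from $x$ to $\omega$ and from $o$ to $\omega$ meet, and put $\mathfrak h(x)=d(x,c)-d(o,c)$. The Diestel–Leader graph $\mathrm{DL}(q,r)$ has vertex set $\{x_1x_2\in\mathbb T_q\times\mathbb T_r:\mathfrak h(x_1)+\mathfrak h(x_2)=0\}$, with $x_1x_2\sim y_1y_2$ if and only if $x_1\sim y_1$ and $x_2\sim y_2$. Let $o=o_1o_2$, and let $P$ be the transition operator of simple random walk, $Pf(x)=\frac1{\deg x}\sum_{y\sim x}f(y)$, acting on $\ell^2(\mathrm{DL}(q,r))$. Let $E$ be the resolution of the identity of the bounded self-adjoint operator $P$, so that $P^N=\int_{\mathrm{spec}(P)}\lambda^N\,E(d\lambda)$ for all integers $N\ge0$, and let $\mu=\mu_{o,o}$, $\mu(d\lambda)=\langle\delta_o,E(d\lambda)\delta_o\rangle$, be the Plancherel measure. For $1\le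 m<n$ put $\lambda_{m,n}=\frac{2\sqrt{qr}}{q+r}\cos\frac{m\pi}{n}$. Then $\mu$ is the sum of point masses $$\mu=\sum_{\substack{1\le m<n\\ \gcd(m,n)=1}}\mu(\{\lambda_{m,n}\})\,\delta_{\lambda_{m,n}},$$ and for all coprime $m,n$ with $1\le m<n$, $$\mu(\{\lambda_{m,n}\})=\begin{cases}\dfrac{\log(1-r^{-n})-\log(1-q^{-n})}{n(r-q)}\cdot\dfrac{2qr(q+r)(q-1)(r-1)\sin^2\frac{m\pi}{n}}{(r-q)^2+4qr\sin^2\frac{m\pi}{n}}, & r\ne q,\\[3mm] \dfrac{(q-1)^2}{q^n-1}, & r=q.\end{cases}$$ -/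

import Mathlib

open MeasureTheory Filter

noncomputable section

namespace DiestelLeader

/-! ### Trees with a root and a reference end -/

section Tree

variable {V : Type*}

/-- A geodesic ray of the graph `T`: `d(ρ i, ρ j) = |i - j|` for all `i, j`. -/
def IsGeodesicRay (T : SimpleGraph V) (ρ : ℕ → V) : Prop :=
  ∀ i j : ℕ, (T.dist (ρ i) (ρ j) : ℤ) = |(i : ℤ) - (j : ℤ)|

/-- The vertex set of the geodesic ray from `x` to the end represented by the ray `ω`: the vertices
`z` that lie on the geodesic between `x` and `ω n` for all large `n`. -/
def geodesicToEnd (T : SimpleGraph V) (ω : ℕ → V) (x : V) : Set V :=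
  {z | ∀ᶠ n in atTop, T.dist x z + T.dist z (ω n) = T.dist x (ω n)}

/-- `up(x) = d(o, c)`, where `o = ω 0` is the root and `c` is the confluent of `x` and `o` with
respect to the end of `ω`, that is, the first vertex of the ray `ω` that also lies on the ray from
`x` to that end. -/
def up (T : SimpleGraph V) (ω : ℕ → V) (x : V) : ℕ :=
  sInf {k | ω k ∈ geodesicToEnd T ω x}

/-- `dn(x) = d(x, c)`, with `c` the confluent of `x` and the root. -/
def dn (T : SimpleGraph V) (ω : ℕ → V) (x : V) : ℕ :=
  T.dist x (ω (up T ω x))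

/-- The Busemann function `hor(x) = dn(x) - up(x)`. -/
def hor (T : SimpleGraph V) (ω : ℕ → V) (x : V) : ℤ :=
  (dn T ω x : ℤ) - (up T ω x : ℤ)

theorem hor_root (T : SimpleGraph V) (ω : ℕ → V) : hor T ω (ω 0) = 0 := by
  have h : up T ω (ω 0) = 0 := by
    apply Nat.sInf_eq_zero.2
    left
    simp [geodesicToEnd]
  simp [hor, dn, h]

end Tree

/-! ### The Diestel-Leader graph -/

section DL

variable {V₁ V₂ : Type*}

/-- Vertices of the horocyclic product of `T₁` and `T₂`: pairs `x₁x₂` with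
`hor(x₁) + hor(x₂) = 0`. -/
abbrev DLVertex (T₁ : SimpleGraph V₁) (ω₁ : ℕ → V₁) (T₂ : SimpleGraph V₂) (ω₂ : ℕ → V₂) : Type _ :=
  {x : V₁ × V₂ // hor T₁ ω₁ x.1 + hor T₂ ω₂ x.2 = 0}

/-- The horocyclic product of `T₁` and `T₂`: `x₁x₂ ∼ y₁y₂` iff `x₁ ∼ y₁` and `x₂ ∼ y₂`. When `T₁`
and `T₂` are the homogeneous trees of degrees `q + 1` and `r + 1`, this is `DL(q, r)`. -/
def DLGraph (T₁ : SimpleGraph V₁) (ω₁ : ℕ → V₁) (T₂ : SimpleGraph V₂) (ω₂ : ℕ → V₂) :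
    SimpleGraph (DLVertex T₁ ω₁ T₂ ω₂) where
  Adj x y := T₁.Adj x.1.1 y.1.1 ∧ T₂.Adj x.1.2 y.1.2
  symm := ⟨fun _ _ h => ⟨h.1.symm, h.2.symm⟩⟩
  loopless := ⟨fun _ h => h.1.ne rfl⟩

/-- The reference vertex `o = o₁o₂`. -/
def DLRoot (T₁ : SimpleGraph V₁) (ω₁ : ℕ → V₁) (T₂ : SimpleGraph V₂) (ω₂ : ℕ → V₂) :
    DLVertex T₁ ω₁ T₂ ω₂ :=
  ⟨(ω₁ 0, ω₂ 0), by simp [hor_root]⟩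

variable (T₁ : SimpleGraph V₁) (ω₁ : ℕ → V₁) (T₂ : SimpleGraph V₂) (ω₂ : ℕ → V₂)

/-- Neighbours in the product, as pairs of neighbours in the factors. -/
def neighborPair (x : DLVertex T₁ ω₁ T₂ ω₂) (y : (DLGraph T₁ ω₁ T₂ ω₂).neighborSet x) :
    T₁.neighborSet x.1.1 × T₂.neighborSet x.1.2 :=
  (⟨y.1.1.1, y.2.1⟩, ⟨y.1.1.2, y.2.2⟩)

theorem neighborPair_injective (x : DLVertex T₁ ω₁ T₂ ω₂) :
    Function.Injective (neighborPair T₁ ω₁ T₂ ω₂ x) := by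
  intro y z h
  simp only [neighborPair, Prod.mk.injEq] at h
  exact Subtype.ext (Subtype.ext (Prod.ext (congrArg Subtype.val h.1) (congrArg Subtype.val h.2)))

instance instLocallyFiniteDLGraph [T₁.LocallyFinite] [T₂.LocallyFinite] : (DLGraph T₁ ω₁ T₂ ω₂).LocallyFinite :=
  fun x => Fintype.ofInjective _ (neighborPair_injective T₁ ω₁ T₂ ω₂ x)

theorem degree_le [T₁.LocallyFinite] [T₂.LocallyFinite] {a b : ℕ}
    (h₁ : T₁.IsRegularOfDegree a) (h₂ : T₂.IsRegularOfDegree b) (x : DLVertex T₁ ω₁ T₂ ω₂) :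
    (DLGraph T₁ ω₁ T₂ ω₂).degree x ≤ a * b := by
  have h := Fintype.card_le_of_injective _ (neighborPair_injective T₁ ω₁ T₂ ω₂ x)
  rw [Fintype.card_prod, SimpleGraph.card_neighborSet_eq_degree,
    SimpleGraph.card_neighborSet_eq_degree, SimpleGraph.card_neighborSet_eq_degree,
    h₁.degree_eq, h₂.degree_eq] at h
  exact h

end DL

/-! ### The simple random walk operator on `ℓ²` -/

section SRW

variable {X : Type*}

/-- The Hilbert space `ℓ²(X)` of complex functions, with respect to the counting measure. -/
abbrev L2 (X : Type*) : Type _ := lp (fun _ : X => ℂ) 2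

/-- Transition probabilities of simple random walk. -/
def transition (G : SimpleGraph X) [G.LocallyFinite] (x y : X) : ℝ :=
  open Classical in if G.Adj x y then 1 / (G.degree x : ℝ) else 0

/-- `Pf(x) = ∑_y p(x,y) f(y)`; the sum may be restricted to the neighbours `y` of `x`. -/
def srwFun (G : SimpleGraph X) [G.LocallyFinite] (f : X → ℂ) (x : X) : ℂ :=
  ∑ y ∈ G.neighborFinset x, (transition G x y : ℂ) * f y

theorem norm_srwFun_sq_le (G : SimpleGraph X) [G.LocallyFinite] (f : X → ℂ) (x : X) :
    ‖srwFun G f x‖ ^ 2 ≤ ∑ y ∈ G.neighborFinset x, ‖f y‖ ^ 2 := by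
  have h1 : ‖srwFun G f x‖ ≤ ∑ y ∈ G.neighborFinset x, transition G x y * ‖f y‖ := by
    refine (norm_sum_le _ _).trans (Finset.sum_le_sum fun y _ => ?_)
    rw [norm_mul, Complex.norm_real, Real.norm_of_nonneg]
    unfold transition
    split_ifs <;> positivity
  have h2 : ∑ y ∈ G.neighborFinset x, transition G x y ^ 2 ≤ 1 := by
    have : ∀ y ∈ G.neighborFinset x, transition G x y ^ 2 = (1 / (G.degree x : ℝ)) ^ 2 := by
      intro y hy
      rw [SimpleGraph.mem_neighborFinset] at hy
      simp [transition, hy]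
    rw [Finset.sum_congr rfl this, Finset.sum_const, SimpleGraph.card_neighborFinset_eq_degree,
      nsmul_eq_mul]
    rcases Nat.eq_zero_or_pos (G.degree x) with h | h
    · simp [h]
    · have h' : (1 : ℝ) ≤ G.degree x := by exact_mod_cast h
      have : (G.degree x : ℝ) * (1 / (G.degree x : ℝ)) ^ 2 = 1 / (G.degree x : ℝ) := by
        field_simp
      rw [this, div_le_one (by linarith)]
      exact h'
  calc ‖srwFun G f x‖ ^ 2
      ≤ (∑ y ∈ G.neighborFinset x, transition G x y * ‖f y‖) ^ 2 := by gcongr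
    _ ≤ (∑ y ∈ G.neighborFinset x, transition G x y ^ 2) *
          ∑ y ∈ G.neighborFinset x, ‖f y‖ ^ 2 := Finset.sum_mul_sq_le_sq_mul_sq _ _ _
    _ ≤ 1 * ∑ y ∈ G.neighborFinset x, ‖f y‖ ^ 2 := by
        gcongr
    _ = _ := one_mul _

theorem sum_norm_srwFun_sq_le (G : SimpleGraph X) [G.LocallyFinite] {d : ℕ}
    (hd : ∀ x, G.degree x ≤ d) (f : L2 X) (s : Finset X) :
    ∑ x ∈ s, ‖srwFun G f x‖ ^ 2 ≤ d * ‖f‖ ^ 2 := by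
  classical
  have hf : ∀ t : Finset X, ∑ y ∈ t, ‖f y‖ ^ 2 ≤ ‖f‖ ^ 2 := by
    intro t
    have := lp.sum_rpow_le_norm_rpow (p := 2) (by norm_num) f t
    simpa using this
  calc ∑ x ∈ s, ‖srwFun G f x‖ ^ 2
      ≤ ∑ x ∈ s, ∑ y ∈ G.neighborFinset x, ‖f y‖ ^ 2 :=
        Finset.sum_le_sum fun x _ => norm_srwFun_sq_le G f x
    _ = ∑ y ∈ s.biUnion (fun x => G.neighborFinset x), ∑ x ∈ s.filter (fun x => G.Adj x y), ‖f y‖ ^ 2 := by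
        apply Finset.sum_comm'
        intro x y
        simp only [SimpleGraph.mem_neighborFinset, Finset.mem_filter, Finset.mem_biUnion]
        constructor
        · rintro ⟨hx, hxy⟩
          exact ⟨⟨hx, hxy⟩, x, hx, hxy⟩
        · rintro ⟨h, -⟩
          exact h
    _ ≤ ∑ y ∈ s.biUnion (fun x => G.neighborFinset x), d * ‖f y‖ ^ 2 := by
        refine Finset.sum_le_sum fun y _ => ?_
        rw [Finset.sum_const, nsmul_eq_mul]
        gcongr
        refine le_trans ?_ (hd y)
        rw [← SimpleGraph.card_neighborFinset_eq_degree]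
        apply Finset.card_le_card
        intro x hx
        rw [Finset.mem_filter] at hx
        rw [SimpleGraph.mem_neighborFinset]
        exact hx.2.symm
    _ ≤ d * ‖f‖ ^ 2 := by
        rw [← Finset.mul_sum]
        gcongr
        exact hf _

theorem memℓp_srwFun (G : SimpleGraph X) [G.LocallyFinite] {d : ℕ}
    (hd : ∀ x, G.degree x ≤ d) (f : L2 X) : Memℓp (srwFun G f) 2 := by
  apply memℓp_gen' (C := d * ‖f‖ ^ 2)
  intro s
  simpa using sum_norm_srwFun_sq_le G hd f s

/-- The simple random walk operator `P` of a graph with bounded degrees, as a bounded operator on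
`ℓ²(X)`. -/
def srwOperator (G : SimpleGraph X) [G.LocallyFinite] {d : ℕ} (hd : ∀ x, G.degree x ≤ d) :
    L2 X →L[ℂ] L2 X :=
  LinearMap.mkContinuous
    { toFun := fun f => ⟨srwFun G f, memℓp_srwFun G hd f⟩
      map_add' := fun f g => by
        ext x
        simp only [srwFun, lp.coeFn_add, Pi.add_apply, mul_add, Finset.sum_add_distrib]
      map_smul' := fun c f => by
        ext x
        simp only [srwFun, lp.coeFn_smul, Pi.smul_apply, smul_eq_mul, RingHom.id_apply,
          Finset.mul_sum]
        exact Finset.sum_congr rfl fun y _ => by ring }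
    (Real.sqrt d)
    (fun f => by
      apply lp.norm_le_of_forall_sum_le (by norm_num) (by positivity)
      intro s
      have h := sum_norm_srwFun_sq_le G hd f s
      have h2 : (Real.sqrt d * ‖f‖) ^ 2 = d * ‖f‖ ^ 2 := by
        rw [mul_pow, Real.sq_sqrt (Nat.cast_nonneg d)]
      simpa [h2] using h)

theorem srwOperator_apply (G : SimpleGraph X) [G.LocallyFinite] {d : ℕ}
    (hd : ∀ x, G.degree x ≤ d) (f : L2 X) (x : X) :
    srwOperator G hd f x = ∑ y ∈ G.neighborFinset x, (transition G x y : ℂ) * f y := rfl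

/-- The point mass `δ_x` as an element of `ℓ²(X)`. -/
def pointMass (x : X) : L2 X :=
  open Classical in lp.single 2 x (1 : ℂ)

end SRW

/-! ### Resolutions of the identity and spectral measures -/

section Spectral

variable {H : Type*} [NormedAddCommGroup H] [InnerProductSpace ℂ H] [CompleteSpace H]

/-- `μ` is the diagonal matrix element `μ(dt) = ⟨v, E(dt) v⟩`. -/
def IsMatrixElement (E : Set ℝ → H →L[ℂ] H) (v : H) (μ : Measure ℝ) : Prop :=
  ∀ B : Set ℝ, MeasurableSet B → μ B = ENNReal.ofReal (inner ℂ v (E B v)).re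

/-- `E` is the resolution of the identity of the bounded operator `T`: a projection-valued Borel
measure, strongly countably additive and carried by the (real) spectrum of `T`, such that
`T ^ N = ∫ t ^ N E(dt)` for all `N`. The integral is meant in the weak sense; by polarization it
suffices to ask for the diagonal matrix elements. -/
structure IsResolutionOfIdentity (T : H →L[ℂ] H) (E : Set ℝ → H →L[ℂ] H) : Prop where
  isStarProjection : ∀ B, MeasurableSet B → IsStarProjection (E B)
  inter : ∀ A B, MeasurableSet A → MeasurableSet B → E (A ∩ B) = E A * E B
  hasSum : ∀ B : ℕ → Set ℝ, (∀ i, MeasurableSet (B i)) → Pairwise (Function.onFun Disjoint B) →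
    ∀ v, HasSum (fun i => E (B i) v) (E (⋃ i, B i) v)
  spectrum : E {t : ℝ | (t : ℂ) ∈ _root_.spectrum ℂ T} = 1
  moments : ∀ v, ∃ ν : Measure ℝ, IsMatrixElement E v ν ∧
    ∀ N : ℕ, inner ℂ v ((T ^ N) v) = ∫ t, (t : ℂ) ^ N ∂ν

/-- `μ` is the spectral measure `μ(dt) = ⟨v, E(dt) v⟩`, with `E` the resolution of the identity
of `T`. -/
def IsSpectralMeasure (T : H →L[ℂ] H) (v : H) (μ : Measure ℝ) : Prop :=
  ∃ E : Set ℝ → H →L[ℂ] H, IsResolutionOfIdentity T E ∧ IsMatrixElement E v μ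

end Spectral

/-- `μ` is the Plancherel measure `μ_{o,o}` of simple random walk on the horocyclic product of two
regular trees `T₁`, `T₂` with ends `ω₁`, `ω₂`. -/
def IsPlancherelMeasure {V₁ V₂ : Type*} (T₁ : SimpleGraph V₁) [T₁.LocallyFinite] (ω₁ : ℕ → V₁)
    (T₂ : SimpleGraph V₂) [T₂.LocallyFinite] (ω₂ : ℕ → V₂) {a b : ℕ}
    (h₁ : T₁.IsRegularOfDegree a) (h₂ : T₂.IsRegularOfDegree b) (μ : Measure ℝ) : Prop :=
  IsSpectralMeasure (srwOperator (DLGraph T₁ ω₁ T₂ ω₂) (degree_le T₁ ω₁ T₂ ω₂ h₁ h₂))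
    (pointMass (DLRoot T₁ ω₁ T₂ ω₂)) μ

/-- `λ_{m,n} = (2√(qr)/(q+r)) cos(mπ/n)`. -/
def eigenvalue (q r m n : ℕ) : ℝ :=
  2 * √((q : ℝ) * r) / ((q : ℝ) + r) * Real.cos ((m : ℝ) / n * Real.pi)

/-- The closed form of the mass of the Plancherel measure at `λ_{m,n}`. -/
def plancherelMass (q r m n : ℕ) : ℝ :=
  if r = q then ((q : ℝ) - 1) ^ 2 / ((q : ℝ) ^ n - 1)
  else
    (Real.log (1 - ((r : ℝ) ^ n)⁻¹) - Real.log (1 - ((q : ℝ) ^ n)⁻¹)) / (n * ((r : ℝ) - q)) *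
      (2 * q * r * ((q : ℝ) + r) * ((q : ℝ) - 1) * ((r : ℝ) - 1) *
          Real.sin ((m : ℝ) / n * Real.pi) ^ 2 /
        (((r : ℝ) - q) ^ 2 + 4 * q * r * Real.sin ((m : ℝ) / n * Real.pi) ^ 2))

end DiestelLeader

end

/-!
The walk operator of `DL(q, r)` has an explicit complete system of finitely supported
eigenfunctions. Write `par` for the parent map of a tree with respect to its end. In the first tree
fix a vertex `w₁`; let `a_k` be the function on the `k`-th generation below the parent of `w₁` that is
`1 - 1/q` below `w₁` and `-1/q` below its siblings (`wave`). Then `a_k ∘ par = a_{k+1}`, and summing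
`a_k` over children gives `q a_{k-1}`, with `a_0 = 0` because the values over the branches cancel. With
the analogous functions `b_k` of a vertex `w₂` of the second tree, the adjacency operator maps
`a_k ⊗ b_{n-k}` to `q a_{k-1} ⊗ b_{n-k+1} + r a_{k+1} ⊗ b_{n-k-1}` (`sum_tetra`). So on the tetrahedron
of height `n` below the parents of `w₁` and `w₂` it acts as an `(n-1) × (n-1)` Jacobi matrix, whose
eigenvectors `k ↦ (r/q)^{k/2} sin(kmπ/n)` belong to the eigenvalues `λ_{m,n}` of the walk.

The point mass at a vertex `x₁` of a tree telescopes into balanced functions, one for each ancestor of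
`x₁` (`sum_wave`). Hence the point mass at `x₁x₂` is a limit of sums, over the pairs of ancestors, of
products `a_i ⊗ b_j`, each of which the discrete sine transform splits into eigenfunctions
(`exists_eigenfunction_decomposition`). This gives a dense span of eigenvectors, hence a resolution of
the identity `E`. Conversely, for any resolution of the identity, `E B` keeps an eigenvector with
eigenvalue in `B` and kills the others (`IsResolutionOfIdentity.apply_eigenvector`), so that the
matrix element `⟨δ_x, E B δ_x⟩` is the sum of the values at `x` of the components with `λ_{m,n} ∈ B`.

These values are `(q-1)(r-1) q^{-i} r^{-j} (2/n) sin²(imπ/n)` with `i + j = n`. The sum over `i`, for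
fixed `m` and `n`, is a geometric sum twisted by a root of unity (`sum_mul_sin_sq`), and the sum over
all multiples `dm/dn` of a reduced fraction is a geometric or a logarithmic series in `d`
(`hasSum_weight`), which produces the closed form of the mass.
-/

noncomputable section

namespace DiestelLeader

/-! ### Parents and children in a regular tree with a reference end -/

section Tree

variable {V : Type*} {T : SimpleGraph V} {ω : ℕ → V}

/-- `par` and `ch` are the parent and children maps of a graph in which every edge joins a vertex to
its parent, every vertex has `q` children, and passing to the parent lowers the height by one. -/
structure IsParentMap (T : SimpleGraph V) (ht : V → ℤ) (q : ℕ) (par : V → V) (ch : V → Finset V) :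
    Prop where
  adj_iff : ∀ x y, T.Adj x y ↔ y = par x ∨ par y = x
  ht_par : ∀ x, ht (par x) = ht x - 1
  mem_ch : ∀ x y, y ∈ ch x ↔ par y = x
  card_ch : ∀ x, (ch x).card = q

theorem IsGeodesicRay.dist_add (hω : IsGeodesicRay T ω) {m n : ℕ} (h : m ≤ n) :
    T.dist (ω m) (ω n) + m = n := by
  have h1 := hω m n
  rw [abs_sub_comm, abs_of_nonneg (by omega)] at h1
  omega

/-- The height `hor x` is the eventual value of `d(x, ω n) - n`. -/
theorem hor_eventually_eq (hT : T.Connected) (hω : IsGeodesicRay T ω) (x : V) :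
    ∀ᶠ n in atTop, (T.dist x (ω n) : ℤ) = hor T ω x + n := by
  -- the integers `d(x, ω n) + d(x, ω 0) - n` are nonnegative and decrease with `n`
  have hanti : Antitone fun n => (T.dist x (ω n) : ℤ) + T.dist x (ω 0) - n := by
    refine antitone_nat_of_succ_le fun n => ?_
    have h1 := hT.dist_triangle (u := x) (v := ω n) (w := ω (n + 1))
    have h2 := hω.dist_add (Nat.le_add_right n 1)
    push_cast
    omega
  have hnn : ∀ n, 0 ≤ (T.dist x (ω n) : ℤ) + T.dist x (ω 0) - n := by
    intro n
    have h1 := hT.dist_triangle (u := ω 0) (v := x) (w := ω n)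
    have h2 := hω.dist_add (Nat.zero_le n)
    rw [SimpleGraph.dist_comm (u := ω 0) (v := x)] at h1
    omega
  obtain ⟨K, hK⟩ : ∃ K, ∀ n ≥ K, (T.dist x (ω n) : ℤ) - n = T.dist x (ω K) - K := by
    have hanti' : Antitone fun n => ((T.dist x (ω n) : ℤ) + T.dist x (ω 0) - n).toNat :=
      fun a b hab => Int.toNat_le_toNat (hanti hab)
    obtain ⟨K, hK⟩ := WellFoundedLT.antitone_chain_condition hanti'
    refine ⟨K, fun n hn => ?_⟩
    have h1 : ((T.dist x (ω K) : ℤ) + T.dist x (ω 0) - K).toNat =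
      ((T.dist x (ω n) : ℤ) + T.dist x (ω 0) - n).toNat := hK n hn
    have := hnn n
    have := hnn K
    omega
  have hmem : up T ω x ∈ {k | ω k ∈ geodesicToEnd T ω x} := by
    refine Nat.sInf_mem ⟨K, ?_⟩
    change ∀ᶠ n in atTop, _
    filter_upwards [eventually_ge_atTop K] with n hn
    have h1 := hω.dist_add hn
    have h2 := hK n hn
    omega
  have hmem' : ∀ᶠ n in atTop, T.dist x (ω (up T ω x)) + T.dist (ω (up T ω x)) (ω n) =
    T.dist x (ω n) := hmem
  filter_upwards [hmem', eventually_ge_atTop (up T ω x)] with n h1 h2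
  have h3 := hω.dist_add h2
  simp only [hor, dn]
  omega

/-- In a tree, a vertex `x ≠ w` has only one neighbour closer to `w`. -/
theorem eq_of_adj_of_dist_add_one (hT : T.IsTree) {x y z w : V} (hy : T.Adj x y) (hz : T.Adj x z)
    (hyw : T.dist y w + 1 = T.dist x w) (hzw : T.dist z w + 1 = T.dist x w) : y = z := by
  obtain ⟨p, hp, hp'⟩ := hT.connected.exists_path_of_dist x w
  have key : ∀ u, T.Adj x u → T.dist u w + 1 = T.dist x w → u = p.snd := by
    intro u hu huw
    obtain ⟨s, hs, hs'⟩ := hT.connected.exists_path_of_dist u w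
    have hns : x ∉ s.support := by
      classical
      intro hx
      have h1 := SimpleGraph.dist_le (s.dropUntil x hx)
      have h2 := s.length_dropUntil_le_length hx
      omega
    have hsp : (SimpleGraph.Walk.cons hu s).IsPath := by simp [hs, hns]
    have := (hT.existsUnique_path x w).unique hp hsp
    rw [this]
    simp
  rw [key y hy hyw, key z hz hzw]

theorem exists_adj_dist_add_one (hT : T.Connected) {x w : V} (h : x ≠ w) :
    ∃ y, T.Adj x y ∧ T.dist y w + 1 = T.dist x w := by
  obtain ⟨p, hp⟩ := hT.exists_walk_length_eq_dist x w
  cases p with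
  | nil => exact absurd rfl h
  | cons hadj s =>
    rename_i y
    refine ⟨y, hadj, ?_⟩
    have h1 := SimpleGraph.dist_le s
    have h2 := hT.dist_triangle (u := x) (v := y) (w := w)
    have h3 := SimpleGraph.dist_eq_one_iff_adj.2 hadj
    rw [SimpleGraph.Walk.length_cons] at hp
    omega

/-- A regular tree of degree `q + 1`, seen from a reference end: each vertex has one parent and
`q` children, and `hor` counts generations. -/
theorem exists_isParentMap [T.LocallyFinite] {q : ℕ} (hT : T.IsTree)
    (hreg : T.IsRegularOfDegree (q + 1)) (hω : IsGeodesicRay T ω) :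
    ∃ par ch, IsParentMap T (hor T ω) q par ch := by
  classical
  -- far out on the ray, distances to `ω n` compare as heights do, for `x` and its neighbours
  have hfar : ∀ x, ∃ w, x ≠ w ∧ ∀ y, T.Adj x y →
      (T.dist y w : ℤ) - T.dist x w = hor T ω y - hor T ω x := by
    intro x
    have h1 : ∀ᶠ n in atTop, ∀ y ∈ T.neighborFinset x, (T.dist y (ω n) : ℤ) = hor T ω y + n :=
      (T.neighborFinset x).eventually_all.2 fun y _ => hor_eventually_eq hT.connected hω y
    obtain ⟨n, hn1, hn2, hn3⟩ := (h1.and ((hor_eventually_eq hT.connected hω x).and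
      (eventually_gt_atTop (-hor T ω x).toNat))).exists
    refine ⟨ω n, ?_, fun y hy => ?_⟩
    · intro h
      rw [← h, SimpleGraph.dist_self] at hn2
      omega
    · have := hn1 y (by simpa using hy)
      omega
  have hpar : ∀ x, ∃ y, T.Adj x y ∧ hor T ω y = hor T ω x - 1 ∧
      ∀ z, T.Adj x z → z ≠ y → hor T ω z = hor T ω x + 1 := by
    intro x
    obtain ⟨w, hxw, hw⟩ := hfar x
    obtain ⟨y, hy, hyw⟩ := exists_adj_dist_add_one hT.connected hxw
    refine ⟨y, hy, ?_, fun z hz hzy => ?_⟩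
    · have := hw y hy
      omega
    · have h1 := hw z hz
      have h2 := hT.dist_eq_dist_add_one_of_adj w hz
      rw [SimpleGraph.dist_comm (u := w), SimpleGraph.dist_comm (u := w)] at h2
      rcases h2 with h2 | h2
      · exact absurd (eq_of_adj_of_dist_add_one hT hz hy h2.symm hyw) hzy
      · omega
  choose par hadj hht huniq using hpar
  have hiff : ∀ x y, T.Adj x y ↔ y = par x ∨ par y = x := by
    intro x y
    constructor
    · intro h
      by_contra! hne
      have h1 := huniq x y h hne.1
      have h2 := huniq y x h.symm hne.2.symm
      omega
    · rintro (rfl | rfl)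
      · exact hadj x
      · exact (hadj y).symm
  refine ⟨par, fun x => (T.neighborFinset x).erase (par x), hiff, hht, fun x y => ?_, fun x => ?_⟩
  · rw [Finset.mem_erase, SimpleGraph.mem_neighborFinset, hiff]
    constructor
    · tauto
    · intro h
      refine ⟨fun h' => ?_, Or.inr h⟩
      have h1 := hht y
      have h2 := hht x
      rw [h] at h1
      rw [← h'] at h2
      omega
  · rw [Finset.card_erase_of_mem (by simpa using hadj x), SimpleGraph.card_neighborFinset_eq_degree,
      hreg.degree_eq, Nat.add_sub_cancel]

end Tree

/-! ### Balanced functions on the branches of a tree -/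

section Wave

variable {V : Type*} {T : SimpleGraph V} {ht : V → ℤ} {q : ℕ} {par : V → V} {ch : V → Finset V}

theorem IsParentMap.ht_iterate (h : IsParentMap T ht q par ch) (k : ℕ) (x : V) :
    ht (par^[k] x) = ht x - k := by
  induction k with
  | zero => simp
  | succ k ih =>
    rw [Function.iterate_succ_apply', h.ht_par, ih]
    push_cast
    ring

open Classical in
/-- The vertices `y` with `par^[k] y = v`. -/
def descendants (ch : V → Finset V) (v : V) : ℕ → Finset V
  | 0 => {v}
  | k + 1 => (descendants ch v k).biUnion ch

theorem IsParentMap.mem_descendants (h : IsParentMap T ht q par ch) (v : V) (k : ℕ) (y : V) :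
    y ∈ descendants ch v k ↔ par^[k] y = v := by
  induction k generalizing y with
  | zero => simp [descendants]
  | succ k ih =>
    simp only [descendants, Finset.mem_biUnion, ih, h.mem_ch, Function.iterate_succ_apply]
    exact ⟨fun ⟨a, ha, hb⟩ => hb ▸ ha, fun hy => ⟨_, hy, rfl⟩⟩

theorem IsParentMap.card_descendants_le (h : IsParentMap T ht q par ch) (v : V) (k : ℕ) :
    (descendants ch v k).card ≤ q ^ k := by
  induction k with
  | zero => simp [descendants]
  | succ k ih =>
    classical
    rw [descendants, pow_succ]
    refine (Finset.card_biUnion_le_card_mul _ _ q fun x _ => (h.card_ch x).le).trans ?_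
    exact Nat.mul_le_mul_right q ih

open Classical in
/-- For `k ≥ 1`, the function on the `k`-th generation below the parent of `w` which is `1 - 1/q`
on the descendants of `w` and `-1/q` on those of its siblings. For `k = 0` it is zero, in agreement
with the fact that the values over the `q` branches add up to zero. -/
def wave (par : V → V) (q : ℕ) (w : V) : ℕ → V → ℝ
  | 0, _ => 0
  | k + 1, y => (if par^[k] y = w then 1 else 0) - (q : ℝ)⁻¹ * if par^[k + 1] y = par w then 1 else 0

@[simp]
theorem wave_zero (w y : V) : wave par q w 0 y = 0 := rfl

theorem wave_par (w y : V) {k : ℕ} (hk : k ≠ 0) :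
    wave par q w k (par y) = wave par q w (k + 1) y := by
  obtain ⟨k, rfl⟩ := Nat.exists_eq_succ_of_ne_zero hk
  rfl

open Classical in
theorem IsParentMap.sum_ch_wave (h : IsParentMap T ht q par ch) (hq : q ≠ 0) (w y : V) (k : ℕ) :
    ∑ z ∈ ch y, wave par q w (k + 1) z = q * wave par q w k y := by
  have hq' : (q : ℝ) ≠ 0 := by exact_mod_cast hq
  have hpar : ∀ z ∈ ch y, par z = y := fun z hz => (h.mem_ch y z).1 hz
  cases k with
  | zero =>
    have h1 : ∀ z ∈ ch y, wave par q w 1 z =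
        (if z = w then 1 else 0) - (q : ℝ)⁻¹ * if y = par w then 1 else 0 := by
      intro z hz
      simp only [wave, Function.iterate_zero, id_eq, zero_add, Function.iterate_one, hpar z hz]
      congr
    rw [Finset.sum_congr rfl h1, Finset.sum_sub_distrib, Finset.sum_const, Finset.sum_ite_eq',
      h.card_ch]
    by_cases hy : par w = y
    · simp [hy, hq', (h.mem_ch y w).2 hy]
    · simp [Ne.symm hy, mt (h.mem_ch y w).1 hy]
  | succ k =>
    have h1 : ∀ z ∈ ch y, wave par q w (k + 2) z = wave par q w (k + 1) y := by
      intro z hz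
      rw [← wave_par _ _ k.succ_ne_zero, hpar z hz]
    rw [Finset.sum_congr rfl h1, Finset.sum_const, h.card_ch, nsmul_eq_mul]

theorem iterate_eq_par_of_wave_ne_zero {w y : V} {k : ℕ} (hy : wave par q w k y ≠ 0) :
    par^[k] y = par w := by
  cases k with
  | zero => simp at hy
  | succ k =>
    by_contra hne
    have h1 : par^[k] y ≠ w := by
      rintro rfl
      exact hne (Function.iterate_succ_apply' par k y)
    exact hy (by simp only [wave, if_neg h1, if_neg hne, mul_zero, sub_zero])

theorem IsParentMap.wave_iterate_eq_zero (h : IsParentMap T ht q par ch) (x : V) {i k : ℕ}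
    (hk : k ≠ i + 1) : wave par q (par^[i] x) k x = 0 := by
  by_contra hne
  have h1 := congrArg ht (iterate_eq_par_of_wave_ne_zero hne)
  rw [h.ht_par, h.ht_iterate, h.ht_iterate] at h1
  omega

theorem wave_iterate_self (x : V) (i : ℕ) : wave par q (par^[i] x) (i + 1) x = 1 - (q : ℝ)⁻¹ := by
  simp [wave, Function.iterate_succ_apply']

open Classical in
/-- The balanced functions add up to the point mass at `x`, up to the uniform distribution on the
vertices that have the same `N`-th ancestor as `x`. -/
theorem sum_wave (x y : V) (N : ℕ) :
    ∑ i ∈ Finset.range N, ((q : ℝ) ^ i)⁻¹ * wave par q (par^[i] x) (i + 1) y =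
      (if y = x then 1 else 0) - ((q : ℝ) ^ N)⁻¹ * if par^[N] y = par^[N] x then 1 else 0 := by
  have h := Finset.sum_range_sub'
    (fun i => ((q : ℝ) ^ i)⁻¹ * if par^[i] y = par^[i] x then 1 else 0) N
  simp only [pow_zero, inv_one, Function.iterate_zero, id_eq, one_mul] at h
  refine Eq.trans (Finset.sum_congr rfl fun i _ => ?_) h
  simp only [wave, Function.iterate_succ_apply' par i x]
  rw [mul_sub, ← mul_assoc, pow_succ, mul_inv]

end Wave

/-! ### Neighbours in the horocyclic product -/

section Neighbors

variable {V₁ V₂ : Type*} {T₁ : SimpleGraph V₁} {ω₁ : ℕ → V₁} {T₂ : SimpleGraph V₂} {ω₂ : ℕ → V₂}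
  [T₁.LocallyFinite] [T₂.LocallyFinite] {q r : ℕ} {par₁ : V₁ → V₁} {par₂ : V₂ → V₂}
  {ch₁ : V₁ → Finset V₁} {ch₂ : V₂ → Finset V₂}

/-- A neighbour in the horocyclic product replaces one coordinate by a child and the other one by
its parent. -/
theorem sum_neighborFinset {M : Type*} [AddCommMonoid M]
    (h₁ : IsParentMap T₁ (hor T₁ ω₁) q par₁ ch₁) (h₂ : IsParentMap T₂ (hor T₂ ω₂) r par₂ ch₂)
    (F : V₁ × V₂ → M) (y : DLVertex T₁ ω₁ T₂ ω₂) :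
    ∑ z ∈ (DLGraph T₁ ω₁ T₂ ω₂).neighborFinset y, F z.1 =
      ∑ z ∈ ch₁ y.1.1, F (z, par₂ y.1.2) + ∑ z ∈ ch₂ y.1.2, F (par₁ y.1.1, z) := by
  classical
  obtain ⟨⟨y₁, y₂⟩, hy⟩ := y
  have hadj : ∀ a b : DLVertex T₁ ω₁ T₂ ω₂, (DLGraph T₁ ω₁ T₂ ω₂).Adj a b ↔
    T₁.Adj a.1.1 b.1.1 ∧ T₂.Adj a.1.2 b.1.2 := fun _ _ => Iff.rfl
  have h1 : ((DLGraph T₁ ω₁ T₂ ω₂).neighborFinset ⟨(y₁, y₂), hy⟩).image Subtype.val =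
      (ch₁ y₁ ×ˢ {par₂ y₂}) ∪ ({par₁ y₁} ×ˢ ch₂ y₂) := by
    ext ⟨z₁, z₂⟩
    simp only [Finset.mem_image, SimpleGraph.mem_neighborFinset, Finset.mem_union,
      Finset.mem_product, Finset.mem_singleton, h₁.mem_ch, h₂.mem_ch, hadj, h₁.adj_iff,
      h₂.adj_iff]
    have a1 := h₁.ht_par y₁
    have a2 := h₂.ht_par y₂
    have b1 := h₁.ht_par z₁
    have b2 := h₂.ht_par z₂
    simp only at hy
    constructor
    · rintro ⟨⟨⟨w₁, w₂⟩, hw⟩, ⟨c1, c2⟩, heq⟩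
      obtain ⟨rfl, rfl⟩ := Prod.mk.inj heq
      simp only at c1 c2 hw
      rcases c1 with c1 | c1 <;> rcases c2 with c2 | c2
      · rw [c1, c2] at hw
        omega
      · exact Or.inr ⟨c1, c2⟩
      · exact Or.inl ⟨c1, c2⟩
      · rw [c1] at b1
        rw [c2] at b2
        omega
    · rintro (⟨c1, c2⟩ | ⟨c1, c2⟩)
      · refine ⟨⟨(z₁, z₂), ?_⟩, ⟨Or.inr c1, Or.inl c2⟩, rfl⟩
        simp only
        rw [c1] at b1
        rw [c2]
        omega
      · refine ⟨⟨(z₁, z₂), ?_⟩, ⟨Or.inl c1, Or.inr c2⟩, rfl⟩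
        simp only
        rw [c2] at b2
        rw [c1]
        omega
  have hdisj : Disjoint (ch₁ y₁ ×ˢ {par₂ y₂}) ({par₁ y₁} ×ˢ ch₂ y₂) := by
    rw [Finset.disjoint_left]
    rintro ⟨z₁, z₂⟩ hz hz'
    simp only [Finset.mem_product, Finset.mem_singleton, h₁.mem_ch] at hz hz'
    have a1 := h₁.ht_par y₁
    have b1 := h₁.ht_par z₁
    rw [hz.1, hz'.1] at b1
    omega
  rw [← Finset.sum_image (f := F) (g := Subtype.val) Subtype.val_injective.injOn, h1,
    Finset.sum_union hdisj, Finset.sum_product, Finset.sum_product]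
  simp

theorem degree_DLGraph
    (h₁ : IsParentMap T₁ (hor T₁ ω₁) q par₁ ch₁) (h₂ : IsParentMap T₂ (hor T₂ ω₂) r par₂ ch₂)
    (y : DLVertex T₁ ω₁ T₂ ω₂) : (DLGraph T₁ ω₁ T₂ ω₂).degree y = q + r := by
  have h := sum_neighborFinset h₁ h₂ (fun _ => 1) y
  simpa [h₁.card_ch, h₂.card_ch] using h

theorem srwFun_DLGraph
    (h₁ : IsParentMap T₁ (hor T₁ ω₁) q par₁ ch₁) (h₂ : IsParentMap T₂ (hor T₂ ω₂) r par₂ ch₂)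
    (F : V₁ × V₂ → ℝ) (y : DLVertex T₁ ω₁ T₂ ω₂) :
    srwFun (DLGraph T₁ ω₁ T₂ ω₂) (fun z => (F z.1 : ℂ)) y =
      (((∑ z ∈ ch₁ y.1.1, F (z, par₂ y.1.2) + ∑ z ∈ ch₂ y.1.2, F (par₁ y.1.1, z)) /
        (q + r : ℝ) : ℝ) : ℂ) := by
  rw [← sum_neighborFinset h₁ h₂ F y, srwFun, Finset.sum_div, Complex.ofReal_sum]
  refine Finset.sum_congr rfl fun z hz => ?_
  rw [SimpleGraph.mem_neighborFinset] at hz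
  rw [transition, if_pos hz, degree_DLGraph h₁ h₂]
  push_cast
  ring

end Neighbors

/-! ### Eigenfunctions supported by tetrahedra -/

section Tetrahedron

variable {V₁ V₂ : Type*} {T₁ : SimpleGraph V₁} {ω₁ : ℕ → V₁} {T₂ : SimpleGraph V₂} {ω₂ : ℕ → V₂}
  {q r : ℕ} {par₁ : V₁ → V₁} {par₂ : V₂ → V₂}
  {ch₁ : V₁ → Finset V₁} {ch₂ : V₂ → Finset V₂}

/-- The function `∑ₖ g(k) a_k(y₁) b_{n-k}(y₂)`, with `a` and `b` the balanced functions of `w₁` and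
`w₂`. On the horocyclic product it lives on the tetrahedron formed by the descendants `y₁` of the
parent of `w₁` and `y₂` of the parent of `w₂`, whose generations add up to `n`; the two apexes
contribute zero. -/
def tetra (par₁ : V₁ → V₁) (par₂ : V₂ → V₂) (q r n : ℕ) (g : ℕ → ℝ) (w₁ : V₁) (w₂ : V₂)
    (y : V₁ × V₂) : ℝ :=
  ∑ k ∈ Finset.range n, g k * (wave par₁ q w₁ k y.1 * wave par₂ r w₂ (n - k) y.2)

/-- The adjacency operator maps `a_k(y₁) b_{n-k}(y₂)` to
`q a_{k-1}(y₁) b_{n-k+1}(y₂) + r a_{k+1}(y₁) b_{n-k-1}(y₂)`, so it acts on `tetra` as a Jacobi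
matrix acts on `g`. -/
theorem sum_tetra (h₁ : IsParentMap T₁ (hor T₁ ω₁) q par₁ ch₁)
    (h₂ : IsParentMap T₂ (hor T₂ ω₂) r par₂ ch₂) (hq : q ≠ 0) (hr : r ≠ 0) (n : ℕ) {g : ℕ → ℝ}
    {Λ : ℝ} (hg0 : g 0 = 0) (hgn : g (n + 1) = 0)
    (hg : ∀ k, q * g (k + 2) + r * g k = Λ * g (k + 1)) (w₁ : V₁) (w₂ : V₂) (y₁ : V₁) (y₂ : V₂) :
    ∑ z ∈ ch₁ y₁, tetra par₁ par₂ q r (n + 1) g w₁ w₂ (z, par₂ y₂) +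
      ∑ z ∈ ch₂ y₂, tetra par₁ par₂ q r (n + 1) g w₁ w₂ (par₁ y₁, z) =
    Λ * tetra par₁ par₂ q r (n + 1) g w₁ w₂ (y₁, y₂) := by
  set Φ : ℕ → ℝ := fun k => wave par₁ q w₁ k y₁ * wave par₂ r w₂ (n + 1 - k) y₂ with hΦ
  have hΦ0 : Φ 0 = 0 := by simp [hΦ]
  have hΦn : Φ (n + 1) = 0 := by simp [hΦ]
  have e1 : ∑ z ∈ ch₁ y₁, tetra par₁ par₂ q r (n + 1) g w₁ w₂ (z, par₂ y₂) =
      ∑ k ∈ Finset.range n, q * g (k + 1) * Φ k := by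
    simp only [tetra]
    rw [Finset.sum_comm, Finset.sum_range_succ']
    simp only [hg0, zero_mul, Finset.sum_const_zero, add_zero]
    refine Finset.sum_congr rfl fun k hk => ?_
    rw [Finset.mem_range] at hk
    rw [← Finset.mul_sum, ← Finset.sum_mul, h₁.sum_ch_wave hq, wave_par _ _ (by omega)]
    simp only [hΦ]
    rw [show n + 1 - (k + 1) + 1 = n + 1 - k by omega]
    ring
  have e2 : ∑ z ∈ ch₂ y₂, tetra par₁ par₂ q r (n + 1) g w₁ w₂ (par₁ y₁, z) =
      ∑ k ∈ Finset.range n, r * g k * Φ (k + 1) := by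
    simp only [tetra]
    have h3 : ∀ k ∈ Finset.range (n + 1),
        ∑ z ∈ ch₂ y₂, g k * (wave par₁ q w₁ k (par₁ y₁) * wave par₂ r w₂ (n + 1 - k) z) =
        r * g k * Φ (k + 1) := by
      intro k hk
      rw [Finset.mem_range] at hk
      rcases Nat.eq_zero_or_pos k with rfl | hk0
      · simp [hg0]
      · rw [← Finset.mul_sum, ← Finset.mul_sum, show n + 1 - k = n - k + 1 by omega,
          h₂.sum_ch_wave hr, wave_par _ _ (by omega)]
        simp only [hΦ]
        rw [show n + 1 - (k + 1) = n - k by omega]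
        ring
    rw [Finset.sum_comm, Finset.sum_congr rfl h3, Finset.sum_range_succ, hΦn, mul_zero, add_zero]
  have e3 : ∑ k ∈ Finset.range n, q * g (k + 1) * Φ k =
      ∑ k ∈ Finset.range n, q * g (k + 2) * Φ (k + 1) := by
    have a := Finset.sum_range_succ (fun k => q * g (k + 1) * Φ k) n
    have b := Finset.sum_range_succ' (fun k => q * g (k + 1) * Φ k) n
    simp only [hΦ0, hgn, mul_zero, zero_mul, add_zero] at a b
    rw [← a, b]
  have e4 : tetra par₁ par₂ q r (n + 1) g w₁ w₂ (y₁, y₂) =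
      ∑ k ∈ Finset.range n, g (k + 1) * Φ (k + 1) := by
    have b := Finset.sum_range_succ' (fun k => g k * Φ k) n
    simp only [hΦ0, mul_zero, add_zero] at b
    rw [← b]
    rfl
  rw [e1, e2, e3, e4, ← Finset.sum_add_distrib, Finset.mul_sum]
  refine Finset.sum_congr rfl fun k _ => ?_
  rw [← add_mul, hg k]
  ring

theorem sqrt_div_pow_recurrence (hq : 2 ≤ q) (θ : ℝ) (k : ℕ) :
    q * (√((r : ℝ) / q) ^ (k + 2) * Real.sin ((k + 2 : ℕ) * θ)) +
      r * (√((r : ℝ) / q) ^ k * Real.sin (k * θ)) =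
    2 * √((q : ℝ) * r) * Real.cos θ *
      (√((r : ℝ) / q) ^ (k + 1) * Real.sin ((k + 1 : ℕ) * θ)) := by
  have hq0 : (0 : ℝ) < q := by exact_mod_cast (by omega : 0 < q)
  have hr0 : (0 : ℝ) ≤ r := Nat.cast_nonneg r
  have e1 : (q : ℝ) * √((r : ℝ) / q) ^ 2 = r := by
    rw [Real.sq_sqrt (by positivity)]
    field_simp
  have e2 : √((q : ℝ) * r) * √((r : ℝ) / q) = r := by
    rw [← Real.sqrt_mul (by positivity), show (q : ℝ) * r * (r / q) = r ^ 2 by field_simp,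
      Real.sqrt_sq hr0]
  have e3 : Real.sin ((k + 2 : ℕ) * θ) + Real.sin (k * θ) =
      2 * Real.cos θ * Real.sin ((k + 1 : ℕ) * θ) := by
    have a : ((k + 2 : ℕ) : ℝ) * θ = (k + 1 : ℕ) * θ + θ := by push_cast; ring
    have b : (k : ℝ) * θ = (k + 1 : ℕ) * θ - θ := by push_cast; ring
    rw [a, b, Real.sin_add, Real.sin_sub]
    ring
  linear_combination (√((r : ℝ) / q) ^ k * Real.sin ((k + 2 : ℕ) * θ)) * e1
    + r * √((r : ℝ) / q) ^ k * e3
    - 2 * Real.cos θ * √((r : ℝ) / q) ^ k * Real.sin ((k + 1 : ℕ) * θ) * e2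

end Tetrahedron

/-! ### Trigonometric sums -/

section Trig

theorem mul_sum_pow_mul_cos (z φ : ℝ) (N : ℕ) :
    (1 - 2 * z * Real.cos φ + z ^ 2) * ∑ k ∈ Finset.range N, z ^ k * Real.cos (k * φ) =
      1 - z * Real.cos φ - z ^ N * Real.cos (N * φ) + z ^ (N + 1) * Real.cos (N * φ - φ) := by
  induction N with
  | zero => simp
  | succ N ih =>
    rw [Finset.sum_range_succ, mul_add, ih]
    have a : ((N + 1 : ℕ) : ℝ) * φ = N * φ + φ := by push_cast; ring
    rw [a, add_sub_cancel_right, Real.cos_add, Real.cos_sub]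
    ring

/-- The real part of the fact that the first `N` powers of an `N`-th root of unity other than `1` add
up to zero. -/
theorem sum_cos_eq_zero {φ : ℝ} {N : ℕ} (hN : Real.cos (N * φ) = 1) (hφ : Real.cos φ ≠ 1) :
    ∑ k ∈ Finset.range N, Real.cos (k * φ) = 0 := by
  have hs : Real.sin (N * φ) = 0 := by
    have := Real.sin_sq_add_cos_sq (N * φ)
    rw [hN] at this
    nlinarith
  have h := mul_sum_pow_mul_cos 1 φ N
  simp only [one_pow, one_mul, Real.cos_sub, hN, hs] at h
  have h' : (2 - 2 * Real.cos φ) * ∑ k ∈ Finset.range N, Real.cos (k * φ) = 0 := by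
    linear_combination h
  rcases mul_eq_zero.1 h' with h0 | h0
  · exact absurd (by linarith) hφ
  · exact h0

/-- Orthogonality of the discrete sine transform. -/
theorem sum_sin_mul_sin {n k l : ℕ} (hk : k < n) (hl : l < n) (hl0 : 0 < l) :
    ∑ m ∈ Finset.range n, Real.sin (k * ((m : ℝ) / n * Real.pi)) *
      Real.sin (l * ((m : ℝ) / n * Real.pi)) = if k = l then (n : ℝ) / 2 else 0 := by
  have hn : (0 : ℝ) < n := by exact_mod_cast (by omega : 0 < n)
  have hpi := Real.pi_pos
  set t : ℕ → ℝ := fun m => Real.sin (k * ((m : ℝ) / n * Real.pi)) *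
      Real.sin (l * ((m : ℝ) / n * Real.pi)) with ht
  -- the summand is invariant under `m ↦ 2n - m`, so the sum is half of the sum over `m < 2n`
  have hrefl : ∀ m ∈ Finset.range n, t (n + (n - 1 - m)) = t (m + 1) := by
    intro m hm
    rw [Finset.mem_range] at hm
    have a : ∀ j : ℕ, Real.sin (j * (((n + (n - 1 - m) : ℕ) : ℝ) / n * Real.pi)) =
        -Real.sin (j * (((m + 1 : ℕ) : ℝ) / n * Real.pi)) := by
      intro j
      have e : ((n + (n - 1 - m) : ℕ) : ℝ) = 2 * n - (m + 1 : ℕ) := by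
        rw [show n + (n - 1 - m) = 2 * n - (m + 1) by omega, Nat.cast_sub (by omega)]
        push_cast
        ring
      rw [e, ← Real.sin_nat_mul_two_pi_sub _ j]
      congr 1
      field_simp
    simp only [ht]
    rw [a, a, neg_mul_neg]
  have hsplit : ∑ m ∈ Finset.range (n + n), t m = 2 * ∑ m ∈ Finset.range n, t m := by
    have t0 : t 0 = 0 := by simp [ht]
    have tn : t n = 0 := by simp [ht, div_self hn.ne']
    have b := Finset.sum_range_succ t n
    rw [Finset.sum_range_succ', t0, tn] at b
    rw [Finset.sum_range_add, ← Finset.sum_range_reflect (fun x => t (n + x)),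
      Finset.sum_congr rfl hrefl]
    linarith
  have hcos : ∀ m : ℕ, t m = (Real.cos (m * (((k : ℝ) - l) / n * Real.pi)) -
      Real.cos (m * (((k : ℝ) + l) / n * Real.pi))) / 2 := by
    intro m
    have e1 : m * (((k : ℝ) - l) / n * Real.pi) =
        k * ((m : ℝ) / n * Real.pi) - l * ((m : ℝ) / n * Real.pi) := by ring
    have e2 : m * (((k : ℝ) + l) / n * Real.pi) =
        k * ((m : ℝ) / n * Real.pi) + l * ((m : ℝ) / n * Real.pi) := by ring
    rw [e1, e2, Real.cos_sub, Real.cos_add]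
    simp only [ht]
    ring
  have hzero : ∀ a : ℤ, a ≠ 0 → -(2 * n : ℤ) < a → a < 2 * n →
      ∑ m ∈ Finset.range (n + n), Real.cos (m * ((a : ℝ) / n * Real.pi)) = 0 := by
    intro a ha h1 h2
    apply sum_cos_eq_zero
    · rw [← Real.cos_int_mul_two_pi a]
      congr 1
      push_cast
      field_simp
      ring
    · have h1' : -(2 * n : ℝ) < a := by exact_mod_cast h1
      have h2' : (a : ℝ) < 2 * n := by exact_mod_cast h2
      have e : (a : ℝ) / n < 2 := by rwa [div_lt_iff₀ hn]
      have e' : -2 < (a : ℝ) / n := by rw [lt_div_iff₀ hn]; linarith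
      rw [Ne, Real.cos_eq_one_iff_of_lt_of_lt (by nlinarith) (by nlinarith)]
      have : (a : ℝ) ≠ 0 := by exact_mod_cast ha
      positivity
  have hplus := hzero (k + l) (by omega) (by omega) (by omega)
  push_cast at hplus
  have h2 : 2 * ∑ m ∈ Finset.range n, t m =
      (∑ m ∈ Finset.range (n + n), Real.cos (m * (((k : ℝ) - l) / n * Real.pi))) / 2 := by
    rw [← hsplit, Finset.sum_congr rfl fun m _ => hcos m, ← Finset.sum_div,
      Finset.sum_sub_distrib, hplus, sub_zero]
  split_ifs with hkl
  · subst hkl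
    simp at h2
    linarith
  · have hminus := hzero (k - l) (by omega) (by omega) (by omega)
    push_cast at hminus
    rw [hminus] at h2
    linarith

/-- The squared sine sum behind the weights of the eigenvalues, for `q ≠ r`. -/
theorem sum_mul_sin_sq {q r θ : ℝ} (hq : 0 < q) (hr : 0 < r) (hqr : r ≠ q) {N : ℕ}
    (hN : Real.sin (N * θ) = 0) (hθ : Real.sin θ ≠ 0) :
    ∑ k ∈ Finset.range N, (q ^ k)⁻¹ * (r ^ (N - k))⁻¹ * (2 * Real.sin (k * θ) ^ 2) =
      ((q ^ N)⁻¹ - (r ^ N)⁻¹) * (2 * q * r * (q + r) * Real.sin θ ^ 2 /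
        ((r - q) * ((r - q) ^ 2 + 4 * q * r * Real.sin θ ^ 2))) := by
  have hc2 : Real.cos (2 * θ) = 1 - 2 * Real.sin θ ^ 2 := by
    rw [Real.cos_two_mul, Real.cos_sq']
    ring
  have hs : 0 < Real.sin θ ^ 2 := by positivity
  set z := r / q with hz
  have hz0 : 0 < z := by positivity
  have hz1 : z - 1 ≠ 0 := by
    rw [hz, div_sub_one hq.ne']
    exact div_ne_zero (sub_ne_zero.2 hqr) hq.ne'
  have hcosN : Real.cos (N * (2 * θ)) = 1 := by
    rw [show N * (2 * θ) = 2 * (N * θ) by ring, Real.cos_two_mul, Real.cos_sq', hN]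
    norm_num
  have hsinN : Real.sin (N * (2 * θ)) = 0 := by
    rw [show N * (2 * θ) = 2 * (N * θ) by ring, Real.sin_two_mul, hN]
    ring
  have h1 : ∑ k ∈ Finset.range N, (q ^ k)⁻¹ * (r ^ (N - k))⁻¹ * (2 * Real.sin (k * θ) ^ 2) =
      (r ^ N)⁻¹ * (∑ k ∈ Finset.range N, z ^ k -
        ∑ k ∈ Finset.range N, z ^ k * Real.cos (k * (2 * θ))) := by
    rw [← Finset.sum_sub_distrib, Finset.mul_sum]
    refine Finset.sum_congr rfl fun k hk => ?_
    rw [Finset.mem_range] at hk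
    have e1 : (k : ℝ) * (2 * θ) = 2 * (k * θ) := by ring
    have e2 : (r ^ N)⁻¹ * z ^ k = (q ^ k)⁻¹ * (r ^ (N - k))⁻¹ := by
      rw [hz, div_pow, ← Nat.sub_add_cancel hk.le, pow_add, Nat.add_sub_cancel]
      field_simp
    rw [e1, Real.cos_two_mul, Real.cos_sq', ← e2]
    ring
  have h2 := mul_sum_pow_mul_cos z (2 * θ) N
  rw [Real.cos_sub, hcosN, hsinN, hc2] at h2
  have h3 := geom_sum_mul z N
  have hD : 0 < (z - 1) ^ 2 + 4 * z * Real.sin θ ^ 2 := by positivity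
  have h4 : ∑ k ∈ Finset.range N, z ^ k -
      ∑ k ∈ Finset.range N, z ^ k * Real.cos (k * (2 * θ)) =
      (z ^ N - 1) * (z * (z + 1) * (2 * Real.sin θ ^ 2)) /
        ((z - 1) * ((z - 1) ^ 2 + 4 * z * Real.sin θ ^ 2)) := by
    rw [eq_div_iff (by positivity)]
    linear_combination ((z - 1) ^ 2 + 4 * z * Real.sin θ ^ 2) * h3 - (z - 1) * h2
  have e3 : (r ^ N)⁻¹ * (z ^ N - 1) = (q ^ N)⁻¹ - (r ^ N)⁻¹ := by
    rw [hz, div_pow]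
    field_simp
  have e4 : z * (z + 1) * (2 * Real.sin θ ^ 2) /
        ((z - 1) * ((z - 1) ^ 2 + 4 * z * Real.sin θ ^ 2)) =
      2 * q * r * (q + r) * Real.sin θ ^ 2 /
        ((r - q) * ((r - q) ^ 2 + 4 * q * r * Real.sin θ ^ 2)) := by
    have a1 : z - 1 = (r - q) / q := by rw [hz]; field_simp
    have a2 : (z - 1) ^ 2 + 4 * z * Real.sin θ ^ 2 =
        ((r - q) ^ 2 + 4 * q * r * Real.sin θ ^ 2) / q ^ 2 := by
      rw [a1, hz]; field_simp
    have a3 : z * (z + 1) = r * (r + q) / q ^ 2 := by rw [hz]; field_simp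
    have b1 : r - q ≠ 0 := sub_ne_zero.2 hqr
    have b2 : (r - q) ^ 2 + 4 * q * r * Real.sin θ ^ 2 ≠ 0 := by positivity
    rw [a2, a1, a3]
    field_simp
    ring
  rw [h1, h4, ← e4, mul_div_assoc, ← mul_assoc, e3]

/-- The squared sine sum behind the weights of the eigenvalues, for `q = r`. -/
theorem sum_mul_sin_sq_self {q θ : ℝ} {N : ℕ} (hN : Real.sin (N * θ) = 0)
    (hθ : Real.sin θ ≠ 0) :
    ∑ k ∈ Finset.range N, (q ^ k)⁻¹ * (q ^ (N - k))⁻¹ * (2 * Real.sin (k * θ) ^ 2) =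
      N * (q ^ N)⁻¹ := by
  have hc2 : Real.cos (2 * θ) ≠ 1 := by
    rw [Real.cos_two_mul, Real.cos_sq']
    have hs : 0 < Real.sin θ ^ 2 := by positivity
    intro h
    linarith
  have hcosN : Real.cos (N * (2 * θ)) = 1 := by
    rw [show N * (2 * θ) = 2 * (N * θ) by ring, Real.cos_two_mul, Real.cos_sq', hN]
    norm_num
  have h0 := sum_cos_eq_zero hcosN hc2
  have h1 : ∀ k ∈ Finset.range N, (q ^ k)⁻¹ * (q ^ (N - k))⁻¹ * (2 * Real.sin (k * θ) ^ 2) =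
      (q ^ N)⁻¹ * (1 - Real.cos (k * (2 * θ))) := by
    intro k hk
    rw [Finset.mem_range] at hk
    rw [← mul_inv, ← pow_add, Nat.add_sub_cancel' hk.le,
      show (k : ℝ) * (2 * θ) = 2 * (k * θ) by ring, Real.cos_two_mul, Real.cos_sq']
    ring
  rw [Finset.sum_congr rfl h1, ← Finset.mul_sum, Finset.sum_sub_distrib, h0]
  simp [mul_comm]

end Trig

/-! ### The weights of the eigenvalues -/

section Weight

/-- The total weight contributed to `λ_{m,n}` at a vertex `x` by the tetrahedra of height `n`: the
summand `k` belongs to the tetrahedron whose apexes are the `k`-th ancestor of `x₁` and the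
`(n-k)`-th ancestor of `x₂`. -/
def weight (q r m n : ℕ) : ℝ :=
  ∑ k ∈ Finset.range n, ((q : ℝ) - 1) * (r - 1) * ((q : ℝ) ^ k)⁻¹ * ((r : ℝ) ^ (n - k))⁻¹ *
    (2 / n) * Real.sin (k * ((m : ℝ) / n * Real.pi)) ^ 2

theorem weight_nonneg {q r : ℕ} (hq : 1 ≤ q) (hr : 1 ≤ r) (m n : ℕ) : 0 ≤ weight q r m n := by
  have hq' : (1 : ℝ) ≤ q := by exact_mod_cast hq
  have hr' : (1 : ℝ) ≤ r := by exact_mod_cast hr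
  have := sub_nonneg.2 hq'
  have := sub_nonneg.2 hr'
  refine Finset.sum_nonneg fun k _ => ?_
  positivity

theorem sin_div_mul_pi_pos {m n : ℕ} (hm : 1 ≤ m) (hmn : m < n) :
    0 < Real.sin ((m : ℝ) / n * Real.pi) := by
  have hm' : (0 : ℝ) < m := by exact_mod_cast hm
  have hn' : (0 : ℝ) < n := by exact_mod_cast (by omega : 0 < n)
  have hmn' : (m : ℝ) < n := by exact_mod_cast hmn
  have := Real.pi_pos
  apply Real.sin_pos_of_pos_of_lt_pi (by positivity)
  have : (m : ℝ) / n < 1 := (div_lt_one hn').2 hmn'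
  nlinarith

/-- Summing the weights of all multiples of the fraction `m/n` gives the closed form of the mass:
a geometric series if `q = r`, and two logarithmic series otherwise. -/
theorem hasSum_weight {q r m n : ℕ} (hq : 2 ≤ q) (hr : 2 ≤ r) (hm : 1 ≤ m) (hmn : m < n) :
    HasSum (fun d : ℕ => weight q r ((d + 1) * m) ((d + 1) * n)) (plancherelMass q r m n) := by
  have hq' : (2 : ℝ) ≤ q := by exact_mod_cast hq
  have hr' : (2 : ℝ) ≤ r := by exact_mod_cast hr
  have hn0 : n ≠ 0 := by omega
  have hn' : (0 : ℝ) < n := by exact_mod_cast (by omega : 0 < n)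
  set θ := (m : ℝ) / n * Real.pi with hθ
  have hsin : Real.sin θ ≠ 0 := (sin_div_mul_pi_pos hm hmn).ne'
  have hsinN : ∀ d : ℕ, Real.sin (((d + 1) * n : ℕ) * θ) = 0 := by
    intro d
    rw [show (((d + 1) * n : ℕ) : ℝ) * θ = ((d + 1) * m : ℕ) * Real.pi by
      rw [hθ]; push_cast; field_simp]
    exact Real.sin_nat_mul_pi _
  have hw : ∀ d : ℕ, weight q r ((d + 1) * m) ((d + 1) * n) =
      ((q : ℝ) - 1) * (r - 1) / ((d + 1) * n : ℕ) * ∑ k ∈ Finset.range ((d + 1) * n),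
        ((q : ℝ) ^ k)⁻¹ * ((r : ℝ) ^ ((d + 1) * n - k))⁻¹ * (2 * Real.sin (k * θ) ^ 2) := by
    intro d
    rw [weight, Finset.mul_sum]
    refine Finset.sum_congr rfl fun k _ => ?_
    have e : (((d + 1) * m : ℕ) : ℝ) / ((d + 1) * n : ℕ) = (m : ℝ) / n := by
      push_cast
      field_simp
    rw [e, ← hθ]
    ring
  have hlt : ∀ a : ℝ, 2 ≤ a → 0 ≤ (a ^ n)⁻¹ ∧ (a ^ n)⁻¹ < 1 := by
    intro a ha
    exact ⟨by positivity, inv_lt_one_of_one_lt₀ (one_lt_pow₀ (by linarith) hn0)⟩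
  have hpow : ∀ (a : ℝ) (d : ℕ), (a ^ ((d + 1) * n))⁻¹ = (a ^ n)⁻¹ ^ (d + 1) := by
    intro a d
    rw [mul_comm, pow_mul, inv_pow]
  simp only [plancherelMass]
  split_ifs with hqr
  · subst hqr
    have h1 : ∀ d : ℕ, weight r r ((d + 1) * m) ((d + 1) * n) =
        ((r : ℝ) - 1) ^ 2 * ((r : ℝ) ^ n)⁻¹ * ((r : ℝ) ^ n)⁻¹ ^ d := by
      intro d
      rw [hw, sum_mul_sin_sq_self (hsinN d) hsin, hpow, pow_succ]
      push_cast
      field_simp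
    simp only [h1]
    obtain ⟨a, b⟩ := hlt r hr'
    have h2 := (hasSum_geometric_of_lt_one a b).mul_left (((r : ℝ) - 1) ^ 2 * ((r : ℝ) ^ n)⁻¹)
    refine (congrArg (fun a => HasSum _ a) ?_).mpr h2
    have : (1 : ℝ) < (r : ℝ) ^ n := one_lt_pow₀ (by linarith) hn0
    have : (r : ℝ) ^ n - 1 ≠ 0 := by linarith
    have e : 1 - ((r : ℝ) ^ n)⁻¹ = ((r : ℝ) ^ n - 1) / (r : ℝ) ^ n := by field_simp
    rw [e]
    field_simp
  · have hqr' : (r : ℝ) ≠ q := by exact_mod_cast hqr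
    have hlog : ∀ a : ℝ, 2 ≤ a →
        HasSum (fun d : ℕ => (a ^ n)⁻¹ ^ (d + 1) / ((d : ℝ) + 1)) (-Real.log (1 - (a ^ n)⁻¹)) := by
      intro a ha
      obtain ⟨h0, h1⟩ := hlt a ha
      exact Real.hasSum_pow_div_log_of_abs_lt_one (by rwa [abs_of_nonneg h0])
    have h2 := ((hlog q hq').sub (hlog r hr')).mul_left (((q : ℝ) - 1) * (r - 1) / n *
      (2 * q * r * (q + r) * Real.sin θ ^ 2 /
        ((r - q) * ((r - q) ^ 2 + 4 * q * r * Real.sin θ ^ 2))))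
    have hb1 : (r : ℝ) - q ≠ 0 := sub_ne_zero.2 hqr'
    have hs : 0 < Real.sin θ ^ 2 := by positivity
    have hb2 : ((r : ℝ) - q) ^ 2 + 4 * q * r * Real.sin θ ^ 2 ≠ 0 := by positivity
    refine (congrArg₂ (fun f a => HasSum f a) (funext fun d => ?_) ?_).mpr h2
    · rw [hw, sum_mul_sin_sq (by linarith) (by linarith) hqr' (hsinN d) hsin, hpow, hpow]
      have : (d : ℝ) + 1 ≠ 0 := by positivity
      push_cast
      field_simp
    · rw [← hθ]
      field_simp
      ring

end Weight

/-! ### Decomposition of a point mass into eigenfunctions -/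

section Decomposition

theorem pointMass_apply {X : Type*} (x y : X) [Decidable (y = x)] :
    pointMass x y = if y = x then 1 else 0 := by
  classical
  rw [pointMass, lp.coeFn_single, Pi.single_apply]
  congr

theorem memℓp_of_finite_support {X : Type*} {f : X → ℂ} (hf : (Function.support f).Finite) :
    Memℓp f 2 :=
  (memℓp_zero hf).of_exponent_ge zero_le

variable {V₁ V₂ : Type*} {T₁ : SimpleGraph V₁} {ω₁ : ℕ → V₁} {T₂ : SimpleGraph V₂} {ω₂ : ℕ → V₂}
  {q r : ℕ} {par₁ : V₁ → V₁} {par₂ : V₂ → V₂}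
  {ch₁ : V₁ → Finset V₁} {ch₂ : V₂ → Finset V₂}

theorem finite_support_tetra (h₁ : IsParentMap T₁ (hor T₁ ω₁) q par₁ ch₁)
    (h₂ : IsParentMap T₂ (hor T₂ ω₂) r par₂ ch₂) (n : ℕ) (g : ℕ → ℝ) (w₁ : V₁) (w₂ : V₂) :
    (Function.support (tetra par₁ par₂ q r n g w₁ w₂)).Finite := by
  classical
  refine Set.Finite.subset (Finset.finite_toSet ((Finset.range n).biUnion fun k =>
    descendants ch₁ (par₁ w₁) k ×ˢ descendants ch₂ (par₂ w₂) (n - k))) fun y hy => ?_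
  obtain ⟨k, hk, hky⟩ := Finset.exists_ne_zero_of_sum_ne_zero hy
  obtain ⟨-, hky⟩ := mul_ne_zero_iff.1 hky
  obtain ⟨ha, hb⟩ := mul_ne_zero_iff.1 hky
  simp only [Finset.coe_biUnion, Set.mem_iUnion, Finset.mem_coe, Finset.mem_product]
  exact ⟨k, hk, (h₁.mem_descendants _ _ _).2 (iterate_eq_par_of_wave_ne_zero ha),
    (h₂.mem_descendants _ _ _).2 (iterate_eq_par_of_wave_ne_zero hb)⟩

/-- The component of the point mass at `x` in the span of the eigenfunctions with index `m` on the
tetrahedron whose apexes are the `(i+1)`-st ancestor of `x₁` and the `(j+1)`-st ancestor of `x₂`. -/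
def component (par₁ : V₁ → V₁) (par₂ : V₂ → V₂) (q r : ℕ) (x : V₁ × V₂) (i j m : ℕ) :
    V₁ × V₂ → ℝ :=
  fun y => ((q : ℝ) ^ i)⁻¹ * ((r : ℝ) ^ j)⁻¹ * (2 / (i + j + 2 : ℕ)) *
    (√((r : ℝ) / q) ^ (i + 1))⁻¹ * Real.sin ((i + 1 : ℕ) * ((m : ℝ) / (i + j + 2 : ℕ) * Real.pi)) *
    tetra par₁ par₂ q r (i + j + 2)
      (fun k => √((r : ℝ) / q) ^ k * Real.sin (k * ((m : ℝ) / (i + j + 2 : ℕ) * Real.pi)))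
      (par₁^[i] x.1) (par₂^[j] x.2) y

theorem finite_support_component (h₁ : IsParentMap T₁ (hor T₁ ω₁) q par₁ ch₁)
    (h₂ : IsParentMap T₂ (hor T₂ ω₂) r par₂ ch₂) (x : V₁ × V₂) (i j m : ℕ) :
    (Function.support (component par₁ par₂ q r x i j m)).Finite :=
  (finite_support_tetra h₁ h₂ (i + j + 2) _ (par₁^[i] x.1) (par₂^[j] x.2)).subset
    fun _ hy => right_ne_zero_of_mul hy

theorem sum_component (hq : 2 ≤ q) (hr : 2 ≤ r) (x : V₁ × V₂) (i j : ℕ) (y : V₁ × V₂) :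
    ∑ m ∈ Finset.range (i + j + 2), component par₁ par₂ q r x i j m y =
      ((q : ℝ) ^ i)⁻¹ * wave par₁ q (par₁^[i] x.1) (i + 1) y.1 *
        (((r : ℝ) ^ j)⁻¹ * wave par₂ r (par₂^[j] x.2) (j + 1) y.2) := by
  have hq0 : (0 : ℝ) < q := by exact_mod_cast (by omega : 0 < q)
  have hr0 : (0 : ℝ) < r := by exact_mod_cast (by omega : 0 < r)
  have hs : √((r : ℝ) / q) ≠ 0 := by positivity
  have hn : ((i + j + 2 : ℕ) : ℝ) ≠ 0 := by positivity
  simp only [component, tetra, Finset.mul_sum]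
  rw [Finset.sum_comm, Finset.sum_eq_single_of_mem (i + 1) (by simp)]
  · have h := sum_sin_mul_sin (n := i + j + 2) (k := i + 1) (l := i + 1) (by omega) (by omega)
      (by omega)
    rw [if_pos rfl] at h
    rw [show i + j + 2 - (i + 1) = j + 1 by omega]
    calc _ = ((q : ℝ) ^ i)⁻¹ * wave par₁ q (par₁^[i] x.1) (i + 1) y.1 *
        (((r : ℝ) ^ j)⁻¹ * wave par₂ r (par₂^[j] x.2) (j + 1) y.2) *
        ((2 / (i + j + 2 : ℕ)) * ∑ m ∈ Finset.range (i + j + 2),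
          Real.sin ((i + 1 : ℕ) * ((m : ℝ) / (i + j + 2 : ℕ) * Real.pi)) *
          Real.sin ((i + 1 : ℕ) * ((m : ℝ) / (i + j + 2 : ℕ) * Real.pi))) := by
          rw [Finset.mul_sum, Finset.mul_sum]
          refine Finset.sum_congr rfl fun m _ => ?_
          field_simp
      _ = _ := by
          rw [h]
          field_simp
  · intro k hk hki
    rw [Finset.mem_range] at hk
    have h := sum_sin_mul_sin (n := i + j + 2) (k := k) (l := i + 1) hk (by omega) (by omega)
    rw [if_neg hki] at h
    calc _ = ((q : ℝ) ^ i)⁻¹ * ((r : ℝ) ^ j)⁻¹ * (2 / (i + j + 2 : ℕ)) *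
          (√((r : ℝ) / q) ^ (i + 1))⁻¹ * √((r : ℝ) / q) ^ k *
          (wave par₁ q (par₁^[i] x.1) k y.1 * wave par₂ r (par₂^[j] x.2) (i + j + 2 - k) y.2) *
          ∑ m ∈ Finset.range (i + j + 2),
          Real.sin (k * ((m : ℝ) / (i + j + 2 : ℕ) * Real.pi)) *
          Real.sin ((i + 1 : ℕ) * ((m : ℝ) / (i + j + 2 : ℕ) * Real.pi)) := by
          rw [Finset.mul_sum]
          refine Finset.sum_congr rfl fun m _ => ?_
          ring
      _ = 0 := by rw [h, mul_zero]

theorem component_self (h₁ : IsParentMap T₁ (hor T₁ ω₁) q par₁ ch₁) (hq : 2 ≤ q) (hr : 2 ≤ r)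
    (x : V₁ × V₂) (i j m : ℕ) :
    component par₁ par₂ q r x i j m x =
      ((q : ℝ) - 1) * (r - 1) * ((q : ℝ) ^ (i + 1))⁻¹ * ((r : ℝ) ^ (j + 1))⁻¹ *
        (2 / (i + j + 2 : ℕ)) *
        Real.sin ((i + 1 : ℕ) * ((m : ℝ) / (i + j + 2 : ℕ) * Real.pi)) ^ 2 := by
  have hq0 : (0 : ℝ) < q := by exact_mod_cast (by omega : 0 < q)
  have hr0 : (0 : ℝ) < r := by exact_mod_cast (by omega : 0 < r)
  have hs : √((r : ℝ) / q) ≠ 0 := by positivity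
  have hn : ((i + j + 2 : ℕ) : ℝ) ≠ 0 := by positivity
  simp only [component, tetra]
  rw [Finset.sum_eq_single_of_mem (i + 1) (by simp)]
  · rw [show i + j + 2 - (i + 1) = j + 1 by omega, wave_iterate_self, wave_iterate_self]
    field_simp
    ring
  · intro k _ hk
    rw [h₁.wave_iterate_eq_zero x.1 hk]
    ring

open Classical in
theorem sum_sum_component (hq : 2 ≤ q) (hr : 2 ≤ r) (x y : V₁ × V₂) (N : ℕ) :
    ∑ i ∈ Finset.range N, ∑ j ∈ Finset.range N, ∑ m ∈ Finset.range (i + j + 2),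
      component par₁ par₂ q r x i j m y =
    ((if y.1 = x.1 then 1 else 0) -
        ((q : ℝ) ^ N)⁻¹ * if par₁^[N] y.1 = par₁^[N] x.1 then 1 else 0) *
      ((if y.2 = x.2 then 1 else 0) -
        ((r : ℝ) ^ N)⁻¹ * if par₂^[N] y.2 = par₂^[N] x.2 then 1 else 0) := by
  simp only [sum_component hq hr]
  rw [← sum_wave x.1 y.1 N, ← sum_wave x.2 y.2 N, Finset.sum_mul_sum]

theorem sum_sq_ite_le (s : Finset (DLVertex T₁ ω₁ T₂ ω₂)) (U : Finset V₁) (W : Finset V₂) (c : ℝ)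
    [∀ y : DLVertex T₁ ω₁ T₂ ω₂, Decidable (y.1.1 ∈ U ∧ y.1.2 ∈ W)] :
    ∑ y ∈ s, (if y.1.1 ∈ U ∧ y.1.2 ∈ W then c else 0) ^ 2 ≤ c ^ 2 * (U.card * W.card) := by
  simp only [ite_pow, ne_eq, OfNat.ofNat_ne_zero, not_false_eq_true, zero_pow]
  rw [← Finset.sum_filter, Finset.sum_const, nsmul_eq_mul, mul_comm]
  have h : (s.filter fun y => y.1.1 ∈ U ∧ y.1.2 ∈ W).card ≤ (U ×ˢ W).card := by
    apply Finset.card_le_card_of_injOn Subtype.val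
    · intro y hy
      simpa using (Finset.mem_filter.1 hy).2
    · exact Subtype.val_injective.injOn
  rw [Finset.card_product] at h
  gcongr
  exact_mod_cast h

variable [T₁.LocallyFinite] [T₂.LocallyFinite]

theorem srwFun_component (h₁ : IsParentMap T₁ (hor T₁ ω₁) q par₁ ch₁)
    (h₂ : IsParentMap T₂ (hor T₂ ω₂) r par₂ ch₂) (hq : 2 ≤ q) (hr : 2 ≤ r) (x : V₁ × V₂)
    (i j m : ℕ) (y : DLVertex T₁ ω₁ T₂ ω₂) :
    srwFun (DLGraph T₁ ω₁ T₂ ω₂) (fun z => (component par₁ par₂ q r x i j m z.1 : ℂ)) y =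
      (eigenvalue q r m (i + j + 2) : ℂ) * (component par₁ par₂ q r x i j m y.1 : ℂ) := by
  have hn : ((i + j + 2 : ℕ) : ℝ) ≠ 0 := by positivity
  rw [srwFun_DLGraph h₁ h₂, ← Complex.ofReal_mul]
  congr 1
  simp only [component, ← Finset.mul_sum]
  rw [← mul_add, sum_tetra h₁ h₂ (by omega) (by omega) (i + j + 1) (by simp) ?_
    (fun k => sqrt_div_pow_recurrence hq ((m : ℝ) / (i + j + 2 : ℕ) * Real.pi) k), eigenvalue]
  · ring
  · have e : ((i + j + 1 + 1 : ℕ) : ℝ) * ((m : ℝ) / (i + j + 2 : ℕ) * Real.pi) = m * Real.pi := by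
      field_simp
    rw [e, Real.sin_nat_mul_pi, mul_zero]

/-- Every point mass of the horocyclic product is a limit of sums of eigenfunctions. -/
theorem exists_eigenfunction_decomposition {a b : ℕ} (hreg₁ : T₁.IsRegularOfDegree a)
    (hreg₂ : T₂.IsRegularOfDegree b) (h₁ : IsParentMap T₁ (hor T₁ ω₁) q par₁ ch₁)
    (h₂ : IsParentMap T₂ (hor T₂ ω₂) r par₂ ch₂) (hq : 2 ≤ q) (hr : 2 ≤ r)
    (x : DLVertex T₁ ω₁ T₂ ω₂) :
    ∃ f : ℕ → ℕ → ℕ → L2 (DLVertex T₁ ω₁ T₂ ω₂),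
      (∀ i j m, srwOperator (DLGraph T₁ ω₁ T₂ ω₂) (degree_le T₁ ω₁ T₂ ω₂ hreg₁ hreg₂) (f i j m) =
        (eigenvalue q r m (i + j + 2) : ℂ) • f i j m) ∧
      (∀ i j m, f i j m x = ((((q : ℝ) - 1) * (r - 1) * ((q : ℝ) ^ (i + 1))⁻¹ *
        ((r : ℝ) ^ (j + 1))⁻¹ * (2 / (i + j + 2 : ℕ)) *
        Real.sin ((i + 1 : ℕ) * ((m : ℝ) / (i + j + 2 : ℕ) * Real.pi)) ^ 2 : ℝ) : ℂ)) ∧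
      Tendsto (fun N => ∑ i ∈ Finset.range N, ∑ j ∈ Finset.range N,
        ∑ m ∈ Finset.range (i + j + 2), f i j m) atTop (nhds (pointMass x)) := by
  classical
  have hmem : ∀ i j m, Memℓp (fun y : DLVertex T₁ ω₁ T₂ ω₂ =>
      (component par₁ par₂ q r x.1 i j m y.1 : ℂ)) 2 := by
    intro i j m
    apply memℓp_of_finite_support
    exact ((finite_support_component h₁ h₂ x.1 i j m).preimage
      Subtype.val_injective.injOn).subset fun y hy h0 => hy (congrArg Complex.ofReal h0)
  refine ⟨fun i j m => ⟨_, hmem i j m⟩, fun i j m => ?_, fun i j m => ?_, ?_⟩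
  · ext y
    exact srwFun_component h₁ h₂ hq hr x.1 i j m y
  · exact congrArg Complex.ofReal (component_self h₁ hq hr x.1 i j m)
  rw [tendsto_iff_norm_sub_tendsto_zero]
  have hlim : Tendsto (fun N : ℕ => 3 * √((2⁻¹ : ℝ) ^ N)) atTop (nhds 0) := by
    have h := (tendsto_pow_atTop_nhds_zero_of_lt_one (r := (2⁻¹ : ℝ)) (by norm_num)
      (by norm_num)).sqrt.const_mul 3
    simpa using h
  refine squeeze_zero (fun _ => norm_nonneg _) (fun N => ?_) hlim
  apply lp.norm_le_of_forall_sum_le (by norm_num) (by positivity)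
  intro s
  have hq0 : (0 : ℝ) < q := by exact_mod_cast (by omega : 0 < q)
  have hr0 : (0 : ℝ) < r := by exact_mod_cast (by omega : 0 < r)
  have hq2 : ((q : ℝ) ^ N)⁻¹ ≤ 2⁻¹ ^ N := by
    rw [← inv_pow]
    gcongr
    exact_mod_cast hq
  have hr2 : ((r : ℝ) ^ N)⁻¹ ≤ 2⁻¹ ^ N := by
    rw [← inv_pow]
    gcongr
    exact_mod_cast hr
  set U := descendants ch₁ (par₁^[N] x.1.1) N
  set W := descendants ch₂ (par₂^[N] x.1.2) N
  have hU : (U.card : ℝ) ≤ (q : ℝ) ^ N := by exact_mod_cast h₁.card_descendants_le _ N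
  have hW : (W.card : ℝ) ≤ (r : ℝ) ^ N := by exact_mod_cast h₂.card_descendants_le _ N
  -- the error is a sum of three constant functions on sets of at most `c⁻¹` elements, where `c` is
  -- the absolute value
  have hpt : ∀ y : DLVertex T₁ ω₁ T₂ ω₂,
      ‖(∑ i ∈ Finset.range N, ∑ j ∈ Finset.range N, ∑ m ∈ Finset.range (i + j + 2),
        (⟨_, hmem i j m⟩ : L2 (DLVertex T₁ ω₁ T₂ ω₂)) - pointMass x) y‖ ^ 2 ≤
      3 * ((if y.1.1 ∈ ({x.1.1} : Finset V₁) ∧ y.1.2 ∈ W then ((r : ℝ) ^ N)⁻¹ else 0) ^ 2 +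
        (if y.1.1 ∈ U ∧ y.1.2 ∈ ({x.1.2} : Finset V₂) then ((q : ℝ) ^ N)⁻¹ else 0) ^ 2 +
        (if y.1.1 ∈ U ∧ y.1.2 ∈ W then ((q : ℝ) ^ N)⁻¹ * ((r : ℝ) ^ N)⁻¹ else 0) ^ 2) := by
    intro y
    have e1 : (∑ i ∈ Finset.range N, ∑ j ∈ Finset.range N, ∑ m ∈ Finset.range (i + j + 2),
        (⟨_, hmem i j m⟩ : L2 (DLVertex T₁ ω₁ T₂ ω₂)) - pointMass x) y =
        ((∑ i ∈ Finset.range N, ∑ j ∈ Finset.range N, ∑ m ∈ Finset.range (i + j + 2),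
          component par₁ par₂ q r x.1 i j m y.1 - if y = x then 1 else 0 : ℝ) : ℂ) := by
      rw [lp.coeFn_sub, Pi.sub_apply, pointMass_apply]
      simp only [lp.coeFn_sum, Finset.sum_apply]
      push_cast
      split_ifs <;> simp
    have e2 : y = x ↔ y.1.1 = x.1.1 ∧ y.1.2 = x.1.2 := by
      rw [Subtype.ext_iff, Prod.ext_iff]
    have hsq : ∀ a b c : ℝ, (-a - b + c) ^ 2 ≤ 3 * (a ^ 2 + b ^ 2 + c ^ 2) := by
      intro a b c
      nlinarith [sq_nonneg (a - b), sq_nonneg (a + c), sq_nonneg (b + c)]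
    rw [e1, Complex.norm_real, Real.norm_eq_abs, sq_abs, sum_sum_component hq hr]
    refine le_trans (le_of_eq ?_) (hsq _ _ _)
    simp only [e2, U, W, h₁.mem_descendants, h₂.mem_descendants, Finset.mem_singleton]
    congr 1
    by_cases c1 : y.1.1 = x.1.1 <;> by_cases c2 : y.1.2 = x.1.2 <;>
      by_cases c3 : par₁^[N] y.1.1 = par₁^[N] x.1.1 <;>
      by_cases c4 : par₂^[N] y.1.2 = par₂^[N] x.1.2 <;> simp [c1, c2, c3, c4] <;> ring
  have hC : (3 * √((2⁻¹ : ℝ) ^ N)) ^ (2 : ENNReal).toReal = 9 * 2⁻¹ ^ N := by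
    simp only [ENNReal.toReal_ofNat, Real.rpow_ofNat]
    rw [mul_pow, Real.sq_sqrt (by positivity)]
    norm_num
  rw [hC]
  simp only [ENNReal.toReal_ofNat, Real.rpow_ofNat]
  refine (Finset.sum_le_sum fun y _ => hpt y).trans ?_
  rw [← Finset.mul_sum, Finset.sum_add_distrib, Finset.sum_add_distrib]
  have b1 : ∑ y ∈ s, (if y.1.1 ∈ ({x.1.1} : Finset V₁) ∧ y.1.2 ∈ W then ((r : ℝ) ^ N)⁻¹ else 0) ^ 2
      ≤ 2⁻¹ ^ N := by
    refine (sum_sq_ite_le s _ W _).trans ?_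
    rw [Finset.card_singleton, Nat.cast_one, one_mul]
    calc (((r : ℝ) ^ N)⁻¹) ^ 2 * W.card ≤ (((r : ℝ) ^ N)⁻¹) ^ 2 * (r : ℝ) ^ N := by gcongr
      _ = ((r : ℝ) ^ N)⁻¹ := by field_simp
      _ ≤ _ := hr2
  have b2 : ∑ y ∈ s, (if y.1.1 ∈ U ∧ y.1.2 ∈ ({x.1.2} : Finset V₂) then ((q : ℝ) ^ N)⁻¹ else 0) ^ 2
      ≤ 2⁻¹ ^ N := by
    refine (sum_sq_ite_le s U _ _).trans ?_
    rw [Finset.card_singleton, Nat.cast_one, mul_one]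
    calc (((q : ℝ) ^ N)⁻¹) ^ 2 * U.card ≤ (((q : ℝ) ^ N)⁻¹) ^ 2 * (q : ℝ) ^ N := by gcongr
      _ = ((q : ℝ) ^ N)⁻¹ := by field_simp
      _ ≤ _ := hq2
  have b3 : ∑ y ∈ s, (if y.1.1 ∈ U ∧ y.1.2 ∈ W then ((q : ℝ) ^ N)⁻¹ * ((r : ℝ) ^ N)⁻¹ else 0) ^ 2
      ≤ 2⁻¹ ^ N := by
    refine (sum_sq_ite_le s U W _).trans ?_
    calc (((q : ℝ) ^ N)⁻¹ * ((r : ℝ) ^ N)⁻¹) ^ 2 * (U.card * W.card)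
        ≤ (((q : ℝ) ^ N)⁻¹ * ((r : ℝ) ^ N)⁻¹) ^ 2 * ((q : ℝ) ^ N * (r : ℝ) ^ N) := by gcongr
      _ = ((q : ℝ) ^ N)⁻¹ * ((r : ℝ) ^ N)⁻¹ := by field_simp
      _ ≤ 2⁻¹ ^ N * 1 := by
        gcongr
        exact inv_le_one_of_one_le₀ (one_le_pow₀ (by exact_mod_cast (by omega : 1 ≤ r)))
      _ = _ := mul_one _
  linarith

end Decomposition

/-! ### Resolutions of the identity with pure point spectrum -/

section Spectral

variable {H : Type*} [NormedAddCommGroup H] [InnerProductSpace ℂ H] [CompleteSpace H]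
  {T : H →L[ℂ] H} {E : Set ℝ → H →L[ℂ] H}

theorem measurableSet_ofReal_mem_spectrum (T : H →L[ℂ] H) :
    MeasurableSet {t : ℝ | (t : ℂ) ∈ _root_.spectrum ℂ T} :=
  ((spectrum.isClosed T).preimage Complex.continuous_ofReal).measurableSet

theorem inner_apply_of_isStarProjection {p : H →L[ℂ] H} (hp : IsStarProjection p) (v : H) :
    inner ℂ v (p v) = ((‖p v‖ ^ 2 : ℝ) : ℂ) := by
  have h1 : p (p v) = p v := congrArg (fun A : H →L[ℂ] H => A v) hp.isIdempotentElem
  have h2 := ContinuousLinearMap.adjoint_inner_left p (p v) v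
  rw [hp.isSelfAdjoint.adjoint_eq, h1] at h2
  rw [← h2, inner_self_eq_norm_sq_to_K]
  simp

namespace IsResolutionOfIdentity

theorem empty (hE : IsResolutionOfIdentity T E) (v : H) : E ∅ v = 0 := by
  have h := hE.hasSum (fun _ => ∅) (fun _ => MeasurableSet.empty)
    (fun _ _ _ => Set.disjoint_empty _) v
  exact tendsto_nhds_unique tendsto_const_nhds h.summable.tendsto_atTop_zero

theorem univ (hE : IsResolutionOfIdentity T E) : E Set.univ = 1 := by
  have h := hE.inter Set.univ _ MeasurableSet.univ (measurableSet_ofReal_mem_spectrum T)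
  rw [Set.univ_inter, hE.spectrum, mul_one] at h
  exact h.symm

theorem apply_add_apply_compl (hE : IsResolutionOfIdentity T E) {B : Set ℝ}
    (hB : MeasurableSet B) (v : H) : E B v + E Bᶜ v = v := by
  set D : ℕ → Set ℝ := fun i => if i = 0 then B else if i = 1 then Bᶜ else ∅ with hD
  have hm : ∀ i, MeasurableSet (D i) := by
    intro i
    simp only [hD]
    split_ifs
    exacts [hB, hB.compl, MeasurableSet.empty]
  have hd : Pairwise (Function.onFun Disjoint D) := by
    intro i j hij
    simp only [hD, Function.onFun]
    split_ifs <;> first | omega | simp [disjoint_compl_right, disjoint_compl_left]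
  have hU : ⋃ i, D i = Set.univ := by
    refine Set.eq_univ_of_forall fun t => Set.mem_iUnion.2 ?_
    by_cases ht : t ∈ B
    · exact ⟨0, by simpa [hD] using ht⟩
    · exact ⟨1, by simpa [hD] using ht⟩
  have h1 := hE.hasSum D hm hd v
  rw [hU, hE.univ] at h1
  have h2 : HasSum (fun i => E (D i) v) (∑ i ∈ Finset.range 2, E (D i) v) := by
    apply hasSum_sum_of_ne_finset_zero
    intro i hi
    rw [Finset.mem_range] at hi
    have : D i = ∅ := by
      simp only [hD]
      rw [if_neg (by omega), if_neg (by omega)]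
    rw [this, hE.empty]
  have h3 := h2.unique h1
  simpa [hD, Finset.sum_range_succ] using h3

/-- The spectral projection of `{t}ᶜ` kills the eigenvectors with eigenvalue `t`, since the second
moment of their spectral measure about `t` vanishes. -/
theorem apply_compl_singleton (hE : IsResolutionOfIdentity T E) {f : H} {t : ℝ}
    (hf : T f = (t : ℂ) • f) : E {t}ᶜ f = 0 := by
  obtain ⟨ν, hν, hmom⟩ := hE.moments f
  have hpow : ∀ N : ℕ, (T ^ N) f = ((t : ℂ) ^ N) • f := by
    intro N
    induction N with
    | zero => simp
    | succ N ih =>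
      rw [pow_succ', mul_apply_eq_comp, ih, map_smul, hf, smul_smul, pow_succ]
  have hmom' : ∀ N : ℕ, ∫ s, s ^ N ∂ν = t ^ N * ‖f‖ ^ 2 := by
    intro N
    have h := hmom N
    simp only [← Complex.ofReal_pow] at h
    rw [integral_complex_ofReal, hpow, inner_smul_right, inner_self_eq_norm_sq_to_K] at h
    have h' : ((t ^ N * ‖f‖ ^ 2 : ℝ) : ℂ) = ((∫ s, s ^ N ∂ν : ℝ) : ℂ) := by
      rw [← h]
      push_cast
      simp
    exact (Complex.ofReal_injective h').symm
  have hfin : IsFiniteMeasure ν := ⟨by rw [hν _ MeasurableSet.univ]; exact ENNReal.ofReal_lt_top⟩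
  have hbdd : ∀ᵐ s ∂ν, |s| ≤ ‖T‖ * ‖(1 : H →L[ℂ] H)‖ := by
    have hS := measurableSet_ofReal_mem_spectrum T
    have h0 : ν {s : ℝ | (s : ℂ) ∈ _root_.spectrum ℂ T}ᶜ = 0 := by
      have h1 := hE.inter _ _ hS.compl hS
      rw [hE.spectrum, mul_one, Set.compl_inter_self] at h1
      rw [hν _ hS.compl, ← h1, hE.empty, inner_zero_right]
      simp
    filter_upwards [measure_eq_zero_iff_ae_notMem.1 h0] with s hs
    simp only [Set.mem_compl_iff, Set.mem_ofPred_eq, not_not] at hs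
    have := spectrum.subset_closedBall_norm_mul T hs
    simpa using this
  have hint : ∀ N : ℕ, Integrable (fun s : ℝ => s ^ N) ν := by
    intro N
    refine Integrable.of_bound (by fun_prop) ((‖T‖ * ‖(1 : H →L[ℂ] H)‖) ^ N) ?_
    filter_upwards [hbdd] with s hs
    rw [norm_pow, Real.norm_eq_abs]
    gcongr
  have hzero : ∫ s, (s - t) ^ 2 ∂ν = 0 := by
    have e : ∀ s : ℝ, (s - t) ^ 2 = s ^ 2 - 2 * t * s ^ 1 + t ^ 2 * s ^ 0 := fun s => by ring
    simp only [e]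
    rw [integral_add (f := fun s => s ^ 2 - 2 * t * s ^ 1)
      ((hint 2).sub ((hint 1).const_mul _)) ((hint 0).const_mul _),
      integral_sub (hint 2) ((hint 1).const_mul _), integral_const_mul, integral_const_mul,
      hmom', hmom', hmom']
    ring
  have hsq : Integrable (fun s : ℝ => (s - t) ^ 2) ν := by
    have e : (fun s : ℝ => (s - t) ^ 2) = fun s => s ^ 2 - 2 * t * s ^ 1 + t ^ 2 * s ^ 0 := by
      funext s
      ring
    rw [e]
    exact ((hint 2).sub ((hint 1).const_mul _)).add ((hint 0).const_mul _)
  have hae := (integral_eq_zero_iff_of_nonneg (fun s => sq_nonneg _) hsq).1 hzero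
  have hnull : ν {t}ᶜ = 0 := by
    refine measure_eq_zero_iff_ae_notMem.2 ?_
    filter_upwards [hae] with s hs
    have : s = t := by
      have : (s - t) ^ 2 = 0 := hs
      nlinarith [pow_eq_zero_iff (two_ne_zero) |>.1 this]
    simpa using this
  have hmeas := (measurableSet_singleton t).compl
  rw [hν _ hmeas, inner_apply_of_isStarProjection (hE.isStarProjection _ hmeas),
    Complex.ofReal_re, ENNReal.ofReal_eq_zero] at hnull
  have : ‖E {t}ᶜ f‖ = 0 := by nlinarith [norm_nonneg (E {t}ᶜ f)]
  exact norm_eq_zero.1 this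

theorem apply_eigenvector (hE : IsResolutionOfIdentity T E) {f : H} {t : ℝ}
    (hf : T f = (t : ℂ) • f) {B : Set ℝ} (hB : MeasurableSet B) [Decidable (t ∈ B)] :
    E B f = if t ∈ B then f else 0 := by
  have h0 := hE.apply_compl_singleton hf
  have key : ∀ A : Set ℝ, MeasurableSet A → t ∉ A → E A f = 0 := by
    intro A hA htA
    have h1 := hE.inter A {t}ᶜ hA (measurableSet_singleton t).compl
    have h2 : A ∩ {t}ᶜ = A := Set.inter_eq_left.2 (by simpa using htA)
    rw [h2] at h1
    rw [h1, mul_apply_eq_comp, h0, map_zero]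
  split_ifs with ht
  · have h1 := hE.apply_add_apply_compl hB f
    rwa [key Bᶜ hB.compl (by simpa using ht), add_zero] at h1
  · exact key B hB ht

end IsResolutionOfIdentity

/-- A self-adjoint operator whose eigenvectors with eigenvalues in a countable set `C` span a dense
subspace has a resolution of the identity: `E B` projects onto the closed span of the eigenvectors
with eigenvalues in `B`. -/
theorem exists_isResolutionOfIdentity (hT : IsSelfAdjoint T) {C : Set ℝ} (hC : C.Countable)
    (hdense : ⊤ ≤ (⨆ c : C, Module.End.eigenspace (T : H →ₗ[ℂ] H) (c : ℂ)).topologicalClosure) :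
    ∃ E, IsResolutionOfIdentity T E := by
  classical
  have : Countable C := hC.to_subtype
  set V : C → Submodule ℂ H := fun c => Module.End.eigenspace (T : H →ₗ[ℂ] H) (c : ℂ) with hV
  have hVmem : ∀ (c : C) (v : H), v ∈ V c ↔ T v = (c : ℂ) • v := fun c v =>
    Module.End.mem_eigenspace_iff
  have hVcl : ∀ c, IsClosed (V c : Set H) := by
    intro c
    have : (V c : Set H) = {v | T v = (c : ℂ) • v} := by
      ext v
      exact hVmem c v
    rw [this]
    exact isClosed_eq T.continuous (continuous_const_smul _)
  have hVcomplete : ∀ c, CompleteSpace (V c) := fun c => (hVcl c).completeSpace_coe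
  have hsymm : (T : H →ₗ[ℂ] H).IsSymmetric := hT.isSymmetric
  have horth : OrthogonalFamily ℂ (fun c => V c) fun c => (V c).subtypeₗᵢ :=
    hsymm.orthogonalFamily_eigenspaces.comp
      (γ := C) (f := fun c => ((c : ℝ) : ℂ)) (Complex.ofReal_injective.comp Subtype.val_injective)
  have hperp : ∀ {c d : C}, c ≠ d → ∀ {v w : H}, v ∈ V c → w ∈ V d → inner ℂ v w = 0 := by
    intro c d hcd v w hv hw
    exact horth hcd ⟨v, hv⟩ ⟨w, hw⟩
  have hsum : IsHilbertSum ℂ (fun c => V c) fun c => (V c).subtypeₗᵢ :=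
    IsHilbertSum.mkInternal V horth hdense
  -- every vector is the sum of its components in the eigenspaces
  have hdecomp : ∀ v : H, ∃ w : C → H, (∀ c, w c ∈ V c) ∧ HasSum w v := by
    intro v
    refine ⟨fun c => (hsum.linearIsometryEquiv v c : H),
      fun c => (hsum.linearIsometryEquiv v c).2, ?_⟩
    have h := hsum.hasSum_linearIsometryEquiv_symm (hsum.linearIsometryEquiv v)
    rwa [LinearIsometryEquiv.symm_apply_apply] at h
  choose w hwV hw using hdecomp
  have hinner : ∀ v c, inner ℂ v (w v c) = ((‖w v c‖ ^ 2 : ℝ) : ℂ) := by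
    intro v c
    have h1 : HasSum (fun d => inner ℂ (w v c) (w v d)) (inner ℂ (w v c) v) :=
      (hw v).mapL (innerSL ℂ (w v c))
    have h2 := hasSum_single (f := fun d => inner ℂ (w v c) (w v d)) c
      fun d hd => hperp hd.symm (hwV v c) (hwV v d)
    rw [← inner_conj_symm, h1.unique h2, inner_self_eq_norm_sq_to_K]
    simp
  have hext : ∀ A B : H →L[ℂ] H, (∀ c, ∀ v ∈ V c, A v = B v) → A = B := by
    intro A B h
    ext v
    refine ((hw v).mapL A).unique ?_
    simp only [h _ _ (hwV v _)]
    exact (hw v).mapL B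
  set E : Set ℝ → H →L[ℂ] H := fun B =>
    (⨆ c : C, ⨆ _ : (c : ℝ) ∈ B, V c).topologicalClosure.starProjection with hEdef
  have hEV : ∀ (B : Set ℝ) (c : C) (v : H), v ∈ V c → E B v = if (c : ℝ) ∈ B then v else 0 := by
    intro B c v hv
    split_ifs with hc
    · rw [hEdef]
      apply Submodule.starProjection_eq_self_iff.2
      exact Submodule.le_topologicalClosure _
        ((le_iSup₂ (f := fun (c : C) (_ : (c : ℝ) ∈ B) => V c) c hc) hv)
    · rw [hEdef]
      apply (Submodule.starProjection_apply_eq_zero_iff _).2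
      rw [Submodule.orthogonal_closure, ← Submodule.iInf_orthogonal]
      rw [Submodule.mem_iInf]
      intro d
      by_cases hd : (d : ℝ) ∈ B
      · rw [iSup_pos hd]
        exact fun u hu => hperp (by rintro rfl; exact hc hd) hu hv
      · simp [hd]
  have hEw : ∀ (B : Set ℝ) (v : H),
      HasSum (Set.indicator {c : C | (c : ℝ) ∈ B} (w v)) (E B v) := by
    intro B v
    have h := (hw v).mapL (E B)
    refine h.congr_fun fun c => ?_
    rw [hEV B c _ (hwV v c), Set.indicator_apply]
    rfl
  refine ⟨E, ⟨fun B _ => isStarProjection_starProjection, ?_, ?_, ?_, ?_⟩⟩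
  · intro A B _ _
    apply hext
    intro c v hv
    rw [mul_apply_eq_comp, hEV _ c v hv, hEV B c v hv]
    by_cases hA : (c : ℝ) ∈ A <;> by_cases hB : (c : ℝ) ∈ B <;> simp [hA, hB, hEV A c v hv]
  · intro B _ hd v
    set D : ℕ → Set C := fun i => {c : C | (c : ℝ) ∈ B i} with hD
    have hDd : Pairwise (Function.onFun Disjoint D) := fun i j hij =>
      (hd hij).preimage (Subtype.val : C → ℝ)
    have h1 := hasSum_subtype_iff_indicator.2 (hEw (⋃ i, B i) v)
    have hU : {c : C | (c : ℝ) ∈ ⋃ i, B i} = ⋃ i, D i := by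
      ext c
      simp [hD]
    rw [hU] at h1
    have h2 := (Equiv.hasSum_iff (Set.unionEqSigmaOfDisjoint hDd).symm).2 h1
    refine h2.sigma fun i => ?_
    exact hasSum_subtype_iff_indicator.2 (hEw (B i) v)
  · apply hext
    intro c v hv
    rw [hEV _ c v hv, one_apply_eq_self]
    by_cases hv0 : v = 0
    · simp [hv0]
    · rw [if_pos]
      rw [Set.mem_ofPred_eq, spectrum.mem_iff]
      intro hu
      obtain ⟨u, hu⟩ := hu
      have h1 : ((u⁻¹ : (H →L[ℂ] H)ˣ) : H →L[ℂ] H) ((u : H →L[ℂ] H) v) = v := by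
        rw [← mul_apply_eq_comp, Units.inv_mul, one_apply_eq_self]
      rw [hu] at h1
      have h2 : (algebraMap ℂ (H →L[ℂ] H) (c : ℝ) - T) v = 0 := by
        rw [sub_apply, (hVmem c v).1 hv, Algebra.algebraMap_eq_smul_one]
        simp
      rw [h2, map_zero] at h1
      exact hv0 h1.symm
  · intro v
    refine ⟨Measure.sum fun c : C => ENNReal.ofReal (‖w v c‖ ^ 2) • Measure.dirac (c : ℝ), ?_, ?_⟩
    · intro B hB
      have h1 : HasSum (fun c => inner ℂ v (Set.indicator {c : C | (c : ℝ) ∈ B} (w v) c))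
          (inner ℂ v (E B v)) := (hEw B v).mapL (innerSL ℂ v)
      have h2 : HasSum (Set.indicator {c : C | (c : ℝ) ∈ B} fun c => ‖w v c‖ ^ 2)
          (inner ℂ v (E B v)).re := by
        refine (h1.mapL Complex.reCLM).congr_fun fun c => ?_
        by_cases hc : (c : ℝ) ∈ B
        · rw [Set.indicator_of_mem (show c ∈ {c : C | (c : ℝ) ∈ B} from hc),
            Set.indicator_of_mem (show c ∈ {c : C | (c : ℝ) ∈ B} from hc), hinner]
          rfl
        · rw [Set.indicator_of_notMem (show c ∉ {c : C | (c : ℝ) ∈ B} from hc),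
            Set.indicator_of_notMem (show c ∉ {c : C | (c : ℝ) ∈ B} from hc), inner_zero_right,
            map_zero]
      rw [Measure.sum_apply _ hB, ← h2.tsum_eq, ENNReal.ofReal_tsum_of_nonneg
        (fun c => Set.indicator_nonneg (fun _ _ => by positivity) c) h2.summable]
      refine tsum_congr fun c => ?_
      rw [Measure.smul_apply, Measure.dirac_apply' _ hB, smul_eq_mul]
      by_cases hc : (c : ℝ) ∈ B
      · rw [Set.indicator_of_mem hc,
          Set.indicator_of_mem (show c ∈ {c : C | (c : ℝ) ∈ B} from hc)]
        simp
      · rw [Set.indicator_of_notMem hc,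
          Set.indicator_of_notMem (show c ∉ {c : C | (c : ℝ) ∈ B} from hc)]
        simp
    · intro N
      have hpow : ∀ c, (T ^ N) (w v c) = ((c : ℝ) : ℂ) ^ N • w v c := by
        intro c
        induction N with
        | zero => simp
        | succ N ih =>
          rw [pow_succ', mul_apply_eq_comp, ih, map_smul, (hVmem c _).1 (hwV v c),
            smul_smul, pow_succ]
      have h1 : HasSum (fun c => inner ℂ v ((T ^ N) (w v c))) (inner ℂ v ((T ^ N) v)) :=
        ((hw v).mapL (T ^ N)).mapL (innerSL ℂ v)
      simp only [hpow, inner_smul_right, hinner] at h1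
      have hnorm : ∀ c : C, (ENNReal.ofReal (‖w v c‖ ^ 2)).toReal = ‖w v c‖ ^ 2 := fun c =>
        ENNReal.toReal_ofReal (by positivity)
      have h2 := hasSum_integral_sum_dirac (f := fun t : ℝ => (t : ℂ) ^ N) (x := fun c : C => (c : ℝ))
        (c := fun c : C => ENNReal.ofReal (‖w v c‖ ^ 2)) (fun _ => ENNReal.ofReal_ne_top) (by
          refine h1.summable.norm.congr fun c => ?_
          rw [hnorm, norm_mul, Complex.norm_real, Real.norm_of_nonneg (by positivity), mul_comm])
      refine h1.unique (h2.congr_fun fun c => ?_)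
      rw [hnorm, Complex.real_smul, mul_comm]

end Spectral

/-! ### The walk operator of a regular graph is self-adjoint -/

section SelfAdjoint

variable {X : Type*}

theorem inner_pointMass (x : X) (f : L2 X) : inner ℂ (pointMass x) f = f x := by
  classical
  have h := lp.inner_single_left (𝕜 := ℂ) (G := fun _ : X => ℂ) x (1 : ℂ) f
  rw [pointMass]
  convert h using 1
  simp

theorem hasSum_smul_pointMass (f : L2 X) : HasSum (fun x => f x • pointMass x) f := by
  classical
  refine (lp.hasSum_single (by simp) f).congr_fun fun x => ?_
  ext y
  rw [lp.coeFn_smul, Pi.smul_apply, pointMass_apply, lp.coeFn_single, Pi.single_apply]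
  split_ifs <;> simp

theorem ext_pointMass {A B : L2 X →L[ℂ] L2 X} (h : ∀ x, A (pointMass x) = B (pointMass x)) :
    A = B := by
  refine ContinuousLinearMap.ext fun f => ((hasSum_smul_pointMass f).mapL A).unique ?_
  simp only [map_smul, h]
  simpa only [map_smul] using (hasSum_smul_pointMass f).mapL B

theorem srwOperator_pointMass (G : SimpleGraph X) [G.LocallyFinite] {d : ℕ}
    (hd : ∀ x, G.degree x ≤ d) (x y : X) :
    srwOperator G hd (pointMass x) y = transition G y x := by
  classical
  rw [srwOperator_apply]
  simp only [pointMass_apply, mul_ite, mul_one, mul_zero]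
  rw [Finset.sum_ite_eq']
  simp only [SimpleGraph.mem_neighborFinset]
  split_ifs with h
  · rfl
  · simp [transition, h]

theorem isSelfAdjoint_srwOperator (G : SimpleGraph X) [G.LocallyFinite] {d k : ℕ}
    (hd : ∀ x, G.degree x ≤ d) (hreg : ∀ x, G.degree x = k) :
    IsSelfAdjoint (srwOperator G hd) := by
  rw [ContinuousLinearMap.isSelfAdjoint_iff']
  refine ext_pointMass fun x => ?_
  ext y
  rw [← inner_pointMass, ContinuousLinearMap.adjoint_inner_right, ← inner_conj_symm,
    inner_pointMass, srwOperator_pointMass, srwOperator_pointMass, Complex.conj_ofReal]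
  by_cases h : G.Adj x y
  · simp [transition, hreg, h, h.symm]
  · have h' : ¬G.Adj y x := fun h' => h h'.symm
    simp [transition, h, h']

end SelfAdjoint

/-! ### Regrouping by reduced fractions -/

section Regroup

theorem ofReal_eq_tsum_of_tendsto {t : ℕ × ℕ → ℝ} (ht : ∀ p, 0 ≤ t p) {L : ℝ}
    (h : Tendsto (fun N => ∑ i ∈ Finset.range N, ∑ j ∈ Finset.range N, t (i, j)) atTop (nhds L)) :
    ENNReal.ofReal L = ∑' p, ENNReal.ofReal (t p) := by
  have hsq : Tendsto (fun N : ℕ => Finset.range N ×ˢ Finset.range N) atTop atTop := by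
    refine tendsto_atTop_finset_of_monotone (fun a b hab => ?_) fun p => ?_
    · exact Finset.product_subset_product (Finset.range_mono hab) (Finset.range_mono hab)
    · refine ⟨max p.1 p.2 + 1, ?_⟩
      simp only [Finset.mem_product, Finset.mem_range]
      omega
  have h1 := (ENNReal.summable (f := fun p => ENNReal.ofReal (t p))).hasSum.comp hsq
  refine tendsto_nhds_unique ((ENNReal.continuous_ofReal.tendsto L).comp h) (h1.congr fun N => ?_)
  simp only [Function.comp_apply]
  rw [← Finset.sum_product', ENNReal.ofReal_sum_of_nonneg fun p _ => ht p]

/-- Every fraction `m/n` in `(0, 1)` is a multiple of a unique reduced fraction. -/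
theorem tsum_eq_tsum_coprime (G : ℕ × ℕ → ENNReal) (hG : ∀ m n, ¬(1 ≤ m ∧ m < n) → G (m, n) = 0) :
    ∑' p, G p = ∑' p : {p : ℕ × ℕ // 1 ≤ p.1 ∧ p.1 < p.2 ∧ Nat.Coprime p.1 p.2},
      ∑' d : ℕ, G ((d + 1) * p.1.1, (d + 1) * p.1.2) := by
  rw [← ENNReal.tsum_prod]
  symm
  have hinj : Function.Injective
      (fun a : {p : ℕ × ℕ // 1 ≤ p.1 ∧ p.1 < p.2 ∧ Nat.Coprime p.1 p.2} × ℕ =>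
        ((a.2 + 1) * a.1.1.1, (a.2 + 1) * a.1.1.2)) := by
    rintro ⟨⟨⟨m, n⟩, h1, h2, h3⟩, d⟩ ⟨⟨⟨m', n'⟩, h1', h2', h3'⟩, d'⟩ h
    obtain ⟨ha, hb⟩ := Prod.mk.inj h
    simp only at ha hb h1 h2 h3 h1' h2' h3'
    have hg := congrArg₂ Nat.gcd ha hb
    rw [Nat.gcd_mul_left, Nat.gcd_mul_left, h3, h3', mul_one, mul_one] at hg
    rw [hg] at ha hb
    have hm := Nat.eq_of_mul_eq_mul_left (Nat.succ_pos d') ha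
    have hn := Nat.eq_of_mul_eq_mul_left (Nat.succ_pos d') hb
    have hd : d = d' := by omega
    subst hm hn hd
    rfl
  refine hinj.tsum_eq (f := G) fun p hp => ?_
  obtain ⟨m, n⟩ := p
  have hmn : 1 ≤ m ∧ m < n := by
    by_contra hne
    exact hp (hG m n hne)
  have hg : 0 < Nat.gcd m n := Nat.gcd_pos_of_pos_left _ (by omega)
  have hm := Nat.mul_div_cancel' (Nat.gcd_dvd_left m n)
  have hn := Nat.mul_div_cancel' (Nat.gcd_dvd_right m n)
  refine ⟨⟨⟨(m / Nat.gcd m n, n / Nat.gcd m n), ?_, ?_, ?_⟩, Nat.gcd m n - 1⟩, ?_⟩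
  · exact Nat.div_pos (Nat.gcd_le_left _ (by omega)) hg
  · exact Nat.div_lt_div_of_lt_of_dvd (Nat.gcd_dvd_right m n) hmn.2
  · exact Nat.coprime_div_gcd_div_gcd hg
  · simp only
    rw [Nat.sub_add_cancel hg, hm, hn]

theorem eigenvalue_mul (q r m n d : ℕ) :
    eigenvalue q r ((d + 1) * m) ((d + 1) * n) = eigenvalue q r m n := by
  have e : (((d + 1) * m : ℕ) : ℝ) / ((d + 1) * n : ℕ) = (m : ℝ) / n := by
    push_cast
    exact mul_div_mul_left _ _ (by positivity)
  rw [eigenvalue, eigenvalue, e]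

theorem eigenvalue_injOn {q r : ℕ} (hq : 2 ≤ q) (hr : 2 ≤ r) {m n m' n' : ℕ} (h1 : 1 ≤ m)
    (h2 : m < n) (h3 : Nat.Coprime m n) (h1' : 1 ≤ m') (h2' : m' < n') (h3' : Nat.Coprime m' n')
    (h : eigenvalue q r m n = eigenvalue q r m' n') : m = m' ∧ n = n' := by
  have hq0 : (0 : ℝ) < q := by exact_mod_cast (by omega : 0 < q)
  have hr0 : (0 : ℝ) < r := by exact_mod_cast (by omega : 0 < r)
  have hn0 : (0 : ℝ) < n := by exact_mod_cast (by omega : 0 < n)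
  have hn0' : (0 : ℝ) < n' := by exact_mod_cast (by omega : 0 < n')
  have hmem : ∀ {a b : ℕ}, a < b → (a : ℝ) / b * Real.pi ∈ Set.Icc 0 Real.pi := by
    intro a b hab
    have hb : (0 : ℝ) < b := by exact_mod_cast (by omega : 0 < b)
    have : (a : ℝ) / b ≤ 1 := (div_le_one hb).2 (by exact_mod_cast hab.le)
    exact ⟨by positivity, by nlinarith [Real.pi_pos]⟩
  have hc : 2 * √((q : ℝ) * r) / ((q : ℝ) + r) ≠ 0 := by positivity
  have hcos := Real.injOn_cos (hmem h2) (hmem h2') (mul_left_cancel₀ hc h)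
  have hdiv := mul_right_cancel₀ Real.pi_ne_zero hcos
  rw [div_eq_div_iff hn0.ne' hn0'.ne'] at hdiv
  have hnat : m * n' = m' * n := by exact_mod_cast hdiv
  have d1 : n ∣ n' := h3.symm.dvd_of_dvd_mul_left (Dvd.intro_left _ hnat.symm)
  have d2 : n' ∣ n := h3'.symm.dvd_of_dvd_mul_left (Dvd.intro_left _ hnat)
  obtain rfl := Nat.dvd_antisymm d1 d2
  exact ⟨Nat.eq_of_mul_eq_mul_right (by omega) hnat, rfl⟩

open Classical in
/-- The sum of the weights over all tetrahedra at a vertex is the sum of the masses over all reduced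
fractions. -/
theorem tsum_weight_eq {q r : ℕ} (hq : 2 ≤ q) (hr : 2 ≤ r) (B : Set ℝ) :
    ∑' p : ℕ × ℕ, ENNReal.ofReal (∑ m ∈ Finset.range (p.1 + p.2 + 2),
      if eigenvalue q r m (p.1 + p.2 + 2) ∈ B then
        ((q : ℝ) - 1) * (r - 1) * ((q : ℝ) ^ (p.1 + 1))⁻¹ * ((r : ℝ) ^ (p.2 + 1))⁻¹ *
          (2 / (p.1 + p.2 + 2 : ℕ)) *
          Real.sin ((p.1 + 1 : ℕ) * ((m : ℝ) / (p.1 + p.2 + 2 : ℕ) * Real.pi)) ^ 2 else 0) =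
    ∑' p : {p : ℕ × ℕ // 1 ≤ p.1 ∧ p.1 < p.2 ∧ Nat.Coprime p.1 p.2},
      if eigenvalue q r p.1.1 p.1.2 ∈ B then ENNReal.ofReal (plancherelMass q r p.1.1 p.1.2)
        else 0 := by
  have hq' : (0 : ℝ) ≤ (q : ℝ) - 1 := sub_nonneg.2 (by exact_mod_cast (by omega : 1 ≤ q))
  have hr' : (0 : ℝ) ≤ (r : ℝ) - 1 := sub_nonneg.2 (by exact_mod_cast (by omega : 1 ≤ r))
  have hw : ∀ m n, 0 ≤ weight q r m n := weight_nonneg (by omega) (by omega)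
  set G : ℕ × ℕ → ENNReal := fun p => if 1 ≤ p.1 ∧ p.1 < p.2 then
    (if eigenvalue q r p.1 p.2 ∈ B then ENNReal.ofReal (weight q r p.1 p.2) else 0) else 0 with hG
  have hright : ∑' p, G p = ∑' p : {p : ℕ × ℕ // 1 ≤ p.1 ∧ p.1 < p.2 ∧ Nat.Coprime p.1 p.2},
      if eigenvalue q r p.1.1 p.1.2 ∈ B then ENNReal.ofReal (plancherelMass q r p.1.1 p.1.2)
        else 0 := by
    rw [tsum_eq_tsum_coprime G fun m n h => if_neg h]
    refine tsum_congr fun ⟨⟨m, n⟩, h1, h2, _⟩ => ?_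
    have h3 : ∀ d : ℕ, G ((d + 1) * m, (d + 1) * n) = if eigenvalue q r m n ∈ B then
        ENNReal.ofReal (weight q r ((d + 1) * m) ((d + 1) * n)) else 0 := by
      intro d
      simp only [hG]
      rw [if_pos ⟨Nat.mul_pos d.succ_pos h1, Nat.mul_lt_mul_of_pos_left h2 d.succ_pos⟩,
        eigenvalue_mul]
    simp only [h3]
    split_ifs with hB
    · have h4 := hasSum_weight hq hr h1 h2
      rw [← h4.tsum_eq, ENNReal.ofReal_tsum_of_nonneg (fun d => hw _ _) h4.summable]
    · simp
  have hleft : ∑' p, G p = ∑' s : ℕ, ∑ m ∈ Finset.range (s + 2),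
      if eigenvalue q r m (s + 2) ∈ B then ENNReal.ofReal (weight q r m (s + 2)) else 0 := by
    have h1 : ∑' p, G p = ∑' n, ∑' m, G (m, n) := by
      rw [← (Equiv.prodComm ℕ ℕ).tsum_eq G, ENNReal.tsum_prod']
      rfl
    have h2 : ∀ n, ∑' m, G (m, n) = ∑ m ∈ Finset.range n, G (m, n) := by
      intro n
      refine tsum_eq_sum fun m hm => if_neg fun h => hm (Finset.mem_range.2 h.2)
    rw [h1]
    simp only [h2]
    rw [← (add_left_injective 2).tsum_eq]
    · refine tsum_congr fun s => Finset.sum_congr rfl fun m hm => ?_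
      rw [Finset.mem_range] at hm
      simp only [hG]
      rcases Nat.eq_zero_or_pos m with rfl | hm0
      · simp [weight]
      · rw [if_pos ⟨hm0, hm⟩]
    · intro n hn
      rcases n with _ | _ | n
      · simp at hn
      · simp [hG] at hn
      · exact ⟨n, rfl⟩
  rw [← hright, hleft, ← Finset.HasAntidiagonal.sigmaAntidiagonalEquivProd.tsum_eq, ENNReal.tsum_sigma']
  refine tsum_congr fun s => ?_
  rw [tsum_fintype]
  -- both sides are sums over the tetrahedra of height `s + 2`
  have hanti : ∀ p : Finset.HasAntidiagonal.antidiagonal s, p.1.1 + p.1.2 = s := fun p =>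
    Finset.HasAntidiagonal.mem_antidiagonal.1 p.2
  set t : ℕ → ℕ × ℕ → ℝ := fun m p =>
    ((q : ℝ) - 1) * (r - 1) * ((q : ℝ) ^ (p.1 + 1))⁻¹ * ((r : ℝ) ^ (p.2 + 1))⁻¹ *
      (2 / (s + 2 : ℕ)) * Real.sin ((p.1 + 1 : ℕ) * ((m : ℝ) / (s + 2 : ℕ) * Real.pi)) ^ 2 with ht
  have ht0 : ∀ m p, 0 ≤ t m p := by
    intro m p
    simp only [ht]
    positivity
  have hwt : ∀ m, weight q r m (s + 2) = ∑ p ∈ Finset.HasAntidiagonal.antidiagonal s, t m p := by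
    intro m
    rw [weight, Finset.sum_range_succ', Finset.Nat.sum_antidiagonal_eq_sum_range_succ_mk]
    simp only [Nat.cast_zero, zero_mul, Real.sin_zero]
    rw [zero_pow two_ne_zero, mul_zero, add_zero]
    refine Finset.sum_congr rfl fun k hk => ?_
    rw [Finset.mem_range] at hk
    simp only [ht]
    rw [show s + 2 - (k + 1) = s - k + 1 by omega]
  calc _ = ∑ p : Finset.HasAntidiagonal.antidiagonal s, ENNReal.ofReal (∑ m ∈ Finset.range (s + 2),
        if eigenvalue q r m (s + 2) ∈ B then t m p.1 else 0) := by
        refine Finset.sum_congr rfl fun p _ => ?_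
        have := hanti p
        simp only [Finset.HasAntidiagonal.sigmaAntidiagonalEquivProd_apply, this, ht]
    _ = ∑ p ∈ Finset.HasAntidiagonal.antidiagonal s, ENNReal.ofReal (∑ m ∈ Finset.range (s + 2),
        if eigenvalue q r m (s + 2) ∈ B then t m p else 0) :=
        Finset.sum_coe_sort (Finset.HasAntidiagonal.antidiagonal s) fun p => ENNReal.ofReal
          (∑ m ∈ Finset.range (s + 2), if eigenvalue q r m (s + 2) ∈ B then t m p else 0)
    _ = ENNReal.ofReal (∑ p ∈ Finset.HasAntidiagonal.antidiagonal s, ∑ m ∈ Finset.range (s + 2),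
        if eigenvalue q r m (s + 2) ∈ B then t m p else 0) := by
        rw [ENNReal.ofReal_sum_of_nonneg]
        intro p _
        exact Finset.sum_nonneg fun m _ => by split_ifs <;> simp [ht0]
    _ = _ := by
        rw [Finset.sum_comm, ENNReal.ofReal_sum_of_nonneg]
        · refine Finset.sum_congr rfl fun m _ => ?_
          split_ifs
          · rw [hwt]
          · simp
        · intro m _
          exact Finset.sum_nonneg fun p _ => by split_ifs <;> simp [ht0]

end Regroup

/-! ### The Plancherel measure -/

section Plancherel

variable {V₁ V₂ : Type*} {T₁ : SimpleGraph V₁} {ω₁ : ℕ → V₁} {T₂ : SimpleGraph V₂} {ω₂ : ℕ → V₂}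
  [T₁.LocallyFinite] [T₂.LocallyFinite]
  {q r : ℕ} {par₁ : V₁ → V₁} {par₂ : V₂ → V₂}
  {ch₁ : V₁ → Finset V₁} {ch₂ : V₂ → Finset V₂} {a b : ℕ}

/-- The eigenvectors of the walk operator span a dense subspace. -/
theorem exists_isResolutionOfIdentity_srwOperator (hreg₁ : T₁.IsRegularOfDegree a)
    (hreg₂ : T₂.IsRegularOfDegree b) (h₁ : IsParentMap T₁ (hor T₁ ω₁) q par₁ ch₁)
    (h₂ : IsParentMap T₂ (hor T₂ ω₂) r par₂ ch₂) (hq : 2 ≤ q) (hr : 2 ≤ r) :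
    ∃ E, IsResolutionOfIdentity
      (srwOperator (DLGraph T₁ ω₁ T₂ ω₂) (degree_le T₁ ω₁ T₂ ω₂ hreg₁ hreg₂)) E := by
  set P := srwOperator (DLGraph T₁ ω₁ T₂ ω₂) (degree_le T₁ ω₁ T₂ ω₂ hreg₁ hreg₂) with hP
  have hsa : IsSelfAdjoint P := isSelfAdjoint_srwOperator _ _ (degree_DLGraph h₁ h₂)
  set C : Set ℝ := Set.range fun p : ℕ × ℕ => eigenvalue q r p.1 p.2 with hC
  refine exists_isResolutionOfIdentity hsa (Set.countable_range _ : C.Countable) fun f _ => ?_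
  set K := (⨆ c : C, Module.End.eigenspace (P : L2 (DLVertex T₁ ω₁ T₂ ω₂) →ₗ[ℂ] _) ((c : ℝ) : ℂ))
    with hK
  have hpt : ∀ x, pointMass x ∈ K.topologicalClosure := by
    intro x
    obtain ⟨g, hg, -, hlim⟩ := exists_eigenfunction_decomposition hreg₁ hreg₂ h₁ h₂ hq hr x
    refine K.isClosed_topologicalClosure.mem_of_tendsto hlim (Eventually.of_forall fun N => ?_)
    refine K.le_topologicalClosure (Submodule.sum_mem _ fun i _ => Submodule.sum_mem _ fun j _ =>
      Submodule.sum_mem _ fun m _ => ?_)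
    exact le_iSup (fun c : C => Module.End.eigenspace
      (P : L2 (DLVertex T₁ ω₁ T₂ ω₂) →ₗ[ℂ] _) ((c : ℝ) : ℂ))
      ⟨eigenvalue q r m (i + j + 2), (m, i + j + 2), rfl⟩
      (Module.End.mem_eigenspace_iff.2 (hg i j m))
  exact K.isClosed_topologicalClosure.mem_of_tendsto (hasSum_smul_pointMass f)
    (Eventually.of_forall fun s => Submodule.sum_mem _ fun x _ => Submodule.smul_mem _ _ (hpt x))

open Classical in
/-- The spectral measure of a point mass, for any resolution of the identity. -/
theorem IsResolutionOfIdentity.ofReal_inner_pointMass (hreg₁ : T₁.IsRegularOfDegree a)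
    (hreg₂ : T₂.IsRegularOfDegree b) (h₁ : IsParentMap T₁ (hor T₁ ω₁) q par₁ ch₁)
    (h₂ : IsParentMap T₂ (hor T₂ ω₂) r par₂ ch₂) (hq : 2 ≤ q) (hr : 2 ≤ r)
    {E : Set ℝ → L2 (DLVertex T₁ ω₁ T₂ ω₂) →L[ℂ] L2 (DLVertex T₁ ω₁ T₂ ω₂)}
    (hE : IsResolutionOfIdentity
      (srwOperator (DLGraph T₁ ω₁ T₂ ω₂) (degree_le T₁ ω₁ T₂ ω₂ hreg₁ hreg₂)) E)
    (x : DLVertex T₁ ω₁ T₂ ω₂) {B : Set ℝ} (hB : MeasurableSet B) :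
    ENNReal.ofReal (inner ℂ (pointMass x) (E B (pointMass x))).re =
      ∑' p : {p : ℕ × ℕ // 1 ≤ p.1 ∧ p.1 < p.2 ∧ Nat.Coprime p.1 p.2},
        if eigenvalue q r p.1.1 p.1.2 ∈ B then ENNReal.ofReal (plancherelMass q r p.1.1 p.1.2)
          else 0 := by
  have hq' : (0 : ℝ) ≤ (q : ℝ) - 1 := sub_nonneg.2 (by exact_mod_cast (by omega : 1 ≤ q))
  have hr' : (0 : ℝ) ≤ (r : ℝ) - 1 := sub_nonneg.2 (by exact_mod_cast (by omega : 1 ≤ r))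
  obtain ⟨g, hg, hgx, hlim⟩ := exists_eigenfunction_decomposition hreg₁ hreg₂ h₁ h₂ hq hr x
  rw [← tsum_weight_eq hq hr B]
  apply ofReal_eq_tsum_of_tendsto
  · intro p
    refine Finset.sum_nonneg fun m _ => ?_
    split_ifs
    · positivity
    · rfl
  have hcont : Continuous fun f : L2 (DLVertex T₁ ω₁ T₂ ω₂) =>
      (inner ℂ (pointMass x) (E B f)).re :=
    Complex.continuous_re.comp (continuous_const.inner (E B).continuous)
  refine ((hcont.tendsto _).comp hlim).congr fun N => ?_
  simp only [Function.comp_apply, map_sum, inner_sum, Complex.re_sum]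
  refine Finset.sum_congr rfl fun i _ => Finset.sum_congr rfl fun j _ =>
    Finset.sum_congr rfl fun m _ => ?_
  rw [hE.apply_eigenvector (hg i j m) hB]
  split_ifs
  · rw [inner_pointMass, hgx, Complex.ofReal_re]
  · simp

open Classical in
theorem sum_dirac_apply (q r : ℕ) {B : Set ℝ} (hB : MeasurableSet B) :
    Measure.sum (fun p : {p : ℕ × ℕ // 1 ≤ p.1 ∧ p.1 < p.2 ∧ Nat.Coprime p.1 p.2} =>
      ENNReal.ofReal (plancherelMass q r p.1.1 p.1.2) •
        Measure.dirac (eigenvalue q r p.1.1 p.1.2)) B =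
      ∑' p : {p : ℕ × ℕ // 1 ≤ p.1 ∧ p.1 < p.2 ∧ Nat.Coprime p.1 p.2},
        if eigenvalue q r p.1.1 p.1.2 ∈ B then ENNReal.ofReal (plancherelMass q r p.1.1 p.1.2)
          else 0 := by
  rw [Measure.sum_apply _ hB]
  refine tsum_congr fun p => ?_
  rw [Measure.smul_apply, Measure.dirac_apply' _ hB, smul_eq_mul, Set.indicator_apply]
  simp

end Plancherel

end DiestelLeader
end

theorem corollary4p2 (q r : ℕ) (hq : 2 ≤ q) (hr : 2 ≤ r) {V₁ V₂ : Type*}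
    (T₁ : SimpleGraph V₁) [T₁.LocallyFinite] (T₂ : SimpleGraph V₂) [T₂.LocallyFinite]
    (htree₁ : T₁.IsTree) (htree₂ : T₂.IsTree)
    (hreg₁ : T₁.IsRegularOfDegree (q + 1)) (hreg₂ : T₂.IsRegularOfDegree (r + 1))
    (ω₁ : ℕ → V₁) (hω₁ : DiestelLeader.IsGeodesicRay T₁ ω₁)
    (ω₂ : ℕ → V₂) (hω₂ : DiestelLeader.IsGeodesicRay T₂ ω₂) :
    (∀ μ : MeasureTheory.Measure ℝ,
      DiestelLeader.IsPlancherelMeasure T₁ ω₁ T₂ ω₂ hreg₁ hreg₂ μ ↔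
        μ = MeasureTheory.Measure.sum
          (fun p : {p : ℕ × ℕ // 1 ≤ p.1 ∧ p.1 < p.2 ∧ Nat.Coprime p.1 p.2} =>
            ENNReal.ofReal (DiestelLeader.plancherelMass q r p.1.1 p.1.2) •
              MeasureTheory.Measure.dirac (DiestelLeader.eigenvalue q r p.1.1 p.1.2))) ∧
    (∀ μ : MeasureTheory.Measure ℝ,
      DiestelLeader.IsPlancherelMeasure T₁ ω₁ T₂ ω₂ hreg₁ hreg₂ μ →
        ∀ m n : ℕ, 1 ≤ m → m < n → Nat.Coprime m n →
          μ.real {DiestelLeader.eigenvalue q r m n} = DiestelLeader.plancherelMass q r m n) := by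
  classical
  obtain ⟨par₁, ch₁, h₁⟩ := DiestelLeader.exists_isParentMap htree₁ hreg₁ hω₁
  obtain ⟨par₂, ch₂, h₂⟩ := DiestelLeader.exists_isParentMap htree₂ hreg₂ hω₂
  have hiff : ∀ μ : MeasureTheory.Measure ℝ,
      DiestelLeader.IsPlancherelMeasure T₁ ω₁ T₂ ω₂ hreg₁ hreg₂ μ ↔
        μ = MeasureTheory.Measure.sum
          (fun p : {p : ℕ × ℕ // 1 ≤ p.1 ∧ p.1 < p.2 ∧ Nat.Coprime p.1 p.2} =>
            ENNReal.ofReal (DiestelLeader.plancherelMass q r p.1.1 p.1.2) •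
              MeasureTheory.Measure.dirac (DiestelLeader.eigenvalue q r p.1.1 p.1.2)) := by
    intro μ
    constructor
    · rintro ⟨E, hE, hμ⟩
      ext B hB
      rw [hμ B hB, hE.ofReal_inner_pointMass hreg₁ hreg₂ h₁ h₂ hq hr _ hB,
        DiestelLeader.sum_dirac_apply q r hB]
    · rintro rfl
      obtain ⟨E, hE⟩ := DiestelLeader.exists_isResolutionOfIdentity_srwOperator
        hreg₁ hreg₂ h₁ h₂ hq hr
      refine ⟨E, hE, fun B hB => ?_⟩
      rw [hE.ofReal_inner_pointMass hreg₁ hreg₂ h₁ h₂ hq hr _ hB,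
        DiestelLeader.sum_dirac_apply q r hB]
  refine ⟨hiff, fun μ hμ m n h1 h2 h3 => ?_⟩
  rw [MeasureTheory.measureReal_def, (hiff μ).1 hμ,
    DiestelLeader.sum_dirac_apply q r (measurableSet_singleton _),
    tsum_eq_single ⟨(m, n), h1, h2, h3⟩, if_pos (Set.mem_singleton _), ENNReal.toReal_ofReal]
  · exact (DiestelLeader.hasSum_weight hq hr h1 h2).nonneg
      fun d => DiestelLeader.weight_nonneg (by omega) (by omega) _ _
  · rintro ⟨⟨m', n'⟩, h1', h2', h3'⟩ hne
    refine if_neg fun h => hne ?_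
    obtain ⟨rfl, rfl⟩ := DiestelLeader.eigenvalue_injOn hq hr h1' h2' h3' h1 h2 h3 h
    rfl
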